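/- Theorem (the categorically surjective topology determines a model structure on double categories). Let $\mathbf{Cat}$ be the category of small categories. A functor is \emph{categorically surjective} if it is surjective on objects and full; the one-element families consisting of a categorically surjective functor form a basis of a Grothendieck topology $\tau'$ on $\mathbf{Cat}$. A functor $p$ is \emph{$\tau'$-epi} if the composite of the Yoneda embedding with $\tau'$-sheafification sends $p$ to an epimorphism of sheaves, and a small category $\mathbf{P}$ is \emph{$\tau'$-projective} if every functor $\mathbf{P}\to\mathbf{R}$ lifts along every $\tau'$-epi functor $\mathbf{Q}\to\mathbf{R}$. A (small) double category $\mathbb{D}$ is an internal category in $\mathbf{Cat}$, with object category $\mathbb{D}_0$, morphism category $\mathbb{D}_1$, source $s$ and target $t$; a double functor is an internal functor; they form the category $\mathbf{DblCat}=\mathsf{Cat}(\mathbf{Cat})$. Let $\mathsf{iso}(\mathbb{D})_1\subseteq\mathbb{D}_1$ be the subcategory of horizontally invertible morphisms and squares. For a double functor $F\colon\mathbb{A}\to\mathbb{B}$ let $(\mathbb{P}_F)_0=\mathbb{A}_0\times_{\mathbb{B}_0}\mathsf{iso}(\mathbb{B})_1$ be the pullback of $F_0$ along $t$. Call $F$ *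 a \emph{$\tau'$-equivalence}, $F\in\mathsf{we}(\tau')$, if the square with sides $F_1$, $F_0\times F_0$ and $(s,t)\colon\mathbb{A}_1\to\mathbb{A}_0\times\mathbb{A}_0$, $(s,t)\colon\mathbb{B}_1\to\mathbb{B}_0\times\mathbb{B}_0$ is a pullback in $\mathbf{Cat}$ and the functor $(\mathbb{P}_F)_0\to\mathsf{iso}(\mathbb{B})_1\xrightarrow{s}\mathbb{B}_0$ is $\tau'$-epi; * a \emph{$\tau'$-fibration}, $F\in\mathsf{fib}(\tau')$, if the functor $\mathsf{iso}(\mathbb{A})_1\to(\mathbb{P}_F)_0$ induced by $t$ and $F_1$ is $\tau'$-epi; * a \emph{$\tau'$-cofibration}, $F\in\mathsf{cof}(\tau')$, if it has the left lifting property with respect to all double functors that are both $\tau'$-fibrations and $\tau'$-equivalences. Then: 1. The class $\mathsf{we}(\tau')$ has the 2-out-of-3 property. 2. $\mathbf{Cat}$ has enough $\tau'$-projectives: every small category $\mathbf{C}$ admits a $\tau'$-epi functor from a $\tau'$-projective category. Indeed, the free category on the underlying directed graph of $\mathbf{C}$ is $\tau'$-projective, and its canonical functor to $\mathbf{C}$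 is $\tau'$-epi. Moreover, a small category is $\tau'$-projective if and only if it is isomorphic to the free category on a directed graph. 3. $(\mathbf{DblCat},\mathsf{we}(\tau'),\mathsf{fib}(\tau'),\mathsf{cof}(\tau'))$ is a model category. 4. A double category $\mathbb{X}$ is cofibrant in this model structure if and only if $\mathbb{X}_0$ is isomorphic to the free category on a directed graph. -/

import Mathlib

open CategoryTheory CategoryTheory.Limits HomotopicalAlgebra

universe u v

/-! ### Internal categories -/

/-- An internal category (category object) in a category with pullbacks.  The composition
is a morphism on the object of composable pairs `mor ×_{obj} mor`, written in diagrammatic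
order.  The unit and associativity laws are stated on generalized elements `X ⟶ mor`, which is the
same, by the Yoneda lemma, as stating them on the universal ones. -/
structure InternalCategory (C : Type u) [Category.{v} C] [HasPullbacks C] where
  /-- the object of objects -/
  obj : C
  /-- the object of morphisms -/
  mor : C
  /-- source -/
  src : mor ⟶ obj
  /-- target -/
  tgt : mor ⟶ obj
  /-- identities -/
  one : obj ⟶ mor
  /-- composition of composable pairs -/
  comp : pullback tgt src ⟶ mor
  one_src : one ≫ src = 𝟙 obj
  one_tgt : one ≫ tgt = 𝟙 obj
  comp_src : comp ≫ src = pullback.fst tgt src ≫ src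
  comp_tgt : comp ≫ tgt = pullback.snd tgt src ≫ tgt
  one_comp : ∀ {X : C} (f : X ⟶ mor) (h : (f ≫ src ≫ one) ≫ tgt = f ≫ src),
    pullback.lift (f ≫ src ≫ one) f h ≫ comp = f
  comp_one : ∀ {X : C} (f : X ⟶ mor) (h : f ≫ tgt = (f ≫ tgt ≫ one) ≫ src),
    pullback.lift f (f ≫ tgt ≫ one) h ≫ comp = f
  assoc : ∀ {X : C} (f g h : X ⟶ mor) (hfg : f ≫ tgt = g ≫ src) (hgh : g ≫ tgt = h ≫ src)
    (h₁ : (pullback.lift f g hfg ≫ comp) ≫ tgt = h ≫ src)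
    (h₂ : f ≫ tgt = (pullback.lift g h hgh ≫ comp) ≫ src),
    pullback.lift (pullback.lift f g hfg ≫ comp) h h₁ ≫ comp =
      pullback.lift f (pullback.lift g h hgh ≫ comp) h₂ ≫ comp

namespace InternalCategory

section Basic

variable {C : Type u} [Category.{v} C] [HasPullbacks C]

/-- Composition (in diagrammatic order) of generalized morphisms of an internal category. -/
noncomputable def hcomp (D : InternalCategory C) {X : C} (f g : X ⟶ D.mor)
    (h : f ≫ D.tgt = g ≫ D.src) : X ⟶ D.mor :=
  pullback.lift f g h ≫ D.comp

/-- An internal functor. -/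
@[ext]
structure Hom (D E : InternalCategory C) where
  /-- the effect on objects -/
  obj : D.obj ⟶ E.obj
  /-- the effect on morphisms -/
  mor : D.mor ⟶ E.mor
  src : mor ≫ E.src = D.src ≫ obj
  tgt : mor ≫ E.tgt = D.tgt ≫ obj
  one : D.one ≫ mor = obj ≫ E.one
  comp : D.comp ≫ mor = pullback.map D.tgt D.src E.tgt E.src mor mor obj tgt.symm src.symm ≫ E.comp

/-- The category of internal categories in `C` and internal functors. -/
instance : Category (InternalCategory C) where
  Hom := Hom
  id D :=
    { obj := 𝟙 _
      mor := 𝟙 _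
      src := by simp
      tgt := by simp
      one := by simp
      comp := by simp }
  comp F G :=
    { obj := F.obj ≫ G.obj
      mor := F.mor ≫ G.mor
      src := by rw [Category.assoc, G.src, ← Category.assoc, F.src, Category.assoc]
      tgt := by rw [Category.assoc, G.tgt, ← Category.assoc, F.tgt, Category.assoc]
      one := by rw [← Category.assoc, F.one, Category.assoc, G.one, Category.assoc]
      comp := by
        rw [← Category.assoc, F.comp, Category.assoc, G.comp, ← Category.assoc]
        congr 1
        apply pullback.hom_ext <;>
          simp [pullback.map, pullback.lift_fst, pullback.lift_snd, pullback.lift_fst_assoc, pullback.lift_snd_assoc] }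
  id_comp _ := Hom.ext (Category.id_comp _) (Category.id_comp _)
  comp_id _ := Hom.ext (Category.comp_id _) (Category.comp_id _)
  assoc _ _ _ := Hom.ext (Category.assoc _ _ _) (Category.assoc _ _ _)

/-- The generalized morphism `g` is a two-sided inverse of the generalized morphism `f`. -/
structure IsInverse (D : InternalCategory C) {X : C} (f g : X ⟶ D.mor) : Prop where
  tgt_src : f ≫ D.tgt = g ≫ D.src
  src_tgt : g ≫ D.tgt = f ≫ D.src
  hom_inv : D.hcomp f g tgt_src = f ≫ D.src ≫ D.one
  inv_hom : D.hcomp g f src_tgt = g ≫ D.src ≫ D.one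

theorem comp_hcomp (D : InternalCategory C) {X Y : C} (k : Y ⟶ X) (f g : X ⟶ D.mor)
    (h : f ≫ D.tgt = g ≫ D.src) (h' : (k ≫ f) ≫ D.tgt = (k ≫ g) ≫ D.src) :
    k ≫ D.hcomp f g h = D.hcomp (k ≫ f) (k ≫ g) h' := by
  unfold hcomp
  rw [← Category.assoc]
  congr 1
  apply pullback.hom_ext <;> simp [pullback.lift_fst, pullback.lift_snd]

theorem hcomp_map {D E : InternalCategory C} (F : D ⟶ E) {X : C} (f g : X ⟶ D.mor)
    (h : f ≫ D.tgt = g ≫ D.src) (h' : (f ≫ F.mor) ≫ E.tgt = (g ≫ F.mor) ≫ E.src) :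
    D.hcomp f g h ≫ F.mor = E.hcomp (f ≫ F.mor) (g ≫ F.mor) h' := by
  unfold hcomp
  rw [Category.assoc, F.comp, ← Category.assoc]
  congr 1
  apply pullback.hom_ext <;>
    simp [pullback.map, pullback.lift_fst, pullback.lift_snd, pullback.lift_fst_assoc, pullback.lift_snd_assoc]

theorem IsInverse.precomp {D : InternalCategory C} {X Y : C} {f g : X ⟶ D.mor}
    (h : D.IsInverse f g) (k : Y ⟶ X) : D.IsInverse (k ≫ f) (k ≫ g) where
  tgt_src := by simp [h.tgt_src]
  src_tgt := by simp [h.src_tgt]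
  hom_inv := by rw [← comp_hcomp D k f g h.tgt_src, h.hom_inv, Category.assoc]
  inv_hom := by rw [← comp_hcomp D k g f h.src_tgt, h.inv_hom, Category.assoc]

theorem IsInverse.map {D E : InternalCategory C} (F : D ⟶ E) {X : C} {f g : X ⟶ D.mor}
    (h : D.IsInverse f g) : E.IsInverse (f ≫ F.mor) (g ≫ F.mor) := by
  have h₁ : (f ≫ F.mor) ≫ E.tgt = (g ≫ F.mor) ≫ E.src := by
    rw [Category.assoc, Category.assoc, F.src, F.tgt, ← Category.assoc, h.tgt_src, Category.assoc]
  have h₂ : (g ≫ F.mor) ≫ E.tgt = (f ≫ F.mor) ≫ E.src := by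
    rw [Category.assoc, Category.assoc, F.src, F.tgt, ← Category.assoc, h.src_tgt, Category.assoc]
  refine ⟨h₁, h₂, ?_, ?_⟩
  · rw [← hcomp_map F f g h.tgt_src h₁, h.hom_inv]
    simp only [Category.assoc, F.one]
    rw [← Category.assoc F.mor, F.src, Category.assoc]
  · rw [← hcomp_map F g f h.src_tgt h₂, h.inv_hom]
    simp only [Category.assoc, F.one]
    rw [← Category.assoc F.mor, F.src, Category.assoc]

/-- Inverses are unique. -/
theorem IsInverse.unique {D : InternalCategory C} {X : C} {f g g' : X ⟶ D.mor}
    (h : D.IsInverse f g) (h' : D.IsInverse f g') : g = g' := by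
  have e₁ : D.hcomp g f h.src_tgt = g' ≫ D.src ≫ D.one := by
    rw [h.inv_hom, ← Category.assoc, ← h.tgt_src, h'.tgt_src, Category.assoc]
  have e₂ : D.hcomp f g' h'.tgt_src = g ≫ D.tgt ≫ D.one := by
    rw [h'.hom_inv, ← Category.assoc, ← h.src_tgt, Category.assoc]
  have a₁ : (g' ≫ D.src ≫ D.one) ≫ D.tgt = g' ≫ D.src := by simp [one_tgt]
  have a₂ : g ≫ D.tgt = (g ≫ D.tgt ≫ D.one) ≫ D.src := by simp [one_src]
  have h₁ : D.hcomp g f h.src_tgt ≫ D.tgt = g' ≫ D.src := by rw [e₁, a₁]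
  have h₂ : g ≫ D.tgt = D.hcomp f g' h'.tgt_src ≫ D.src := by rw [e₂, ← a₂]
  have key := D.assoc g f g' h.src_tgt h'.tgt_src h₁ h₂
  change D.hcomp (D.hcomp g f h.src_tgt) g' h₁ = D.hcomp g (D.hcomp f g' h'.tgt_src) h₂ at key
  have l : D.hcomp (D.hcomp g f h.src_tgt) g' h₁ = g' := by
    rw [show D.hcomp (D.hcomp g f h.src_tgt) g' h₁ = D.hcomp (g' ≫ D.src ≫ D.one) g' a₁ by
      congr 1]
    exact D.one_comp g' a₁
  have r : D.hcomp g (D.hcomp f g' h'.tgt_src) h₂ = g := by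
    rw [show D.hcomp g (D.hcomp f g' h'.tgt_src) h₂ = D.hcomp g (g ≫ D.tgt ≫ D.one) a₂ by
      congr 1]
    exact D.comp_one g a₂
  rw [← r, ← key, l]

end Basic

/-! ### The object of isomorphisms and the mapping path object -/

section Iso

variable {C : Type u} [Category.{v} C] [HasFiniteLimits C]

/-- The object of pairs `(f, g)` of morphisms going back and forth between two objects. -/
noncomputable abbrev backForth (D : InternalCategory C) : C :=
  pullback (prod.lift D.src D.tgt) (prod.lift D.tgt D.src)

/-- The first component of a back and forth pair. -/
noncomputable abbrev forth (D : InternalCategory C) : D.backForth ⟶ D.mor :=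
  pullback.fst (prod.lift D.src D.tgt) (prod.lift D.tgt D.src)

/-- The second component of a back and forth pair. -/
noncomputable abbrev back (D : InternalCategory C) : D.backForth ⟶ D.mor :=
  pullback.snd (prod.lift D.src D.tgt) (prod.lift D.tgt D.src)

theorem backForth_tgt_src (D : InternalCategory C) :
    D.forth ≫ D.tgt =
      D.back ≫ D.src := by
  simpa [prod.lift_fst, prod.lift_snd] using congr($(pullback.condition (f := prod.lift D.src D.tgt)
    (g := prod.lift D.tgt D.src)) ≫ prod.snd)

theorem backForth_src_tgt (D : InternalCategory C) :
    D.back ≫ D.tgt =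
      D.forth ≫ D.src := by
  simpa [prod.lift_fst, prod.lift_snd] using congr($(pullback.condition (f := prod.lift D.src D.tgt)
    (g := prod.lift D.tgt D.src)) ≫ prod.fst).symm

/-- The object of isomorphisms of an internal category (the object of morphisms of the internal
groupoid of isomorphisms): the object of pairs of mutually inverse morphisms.  The first component
`isoι` is a monomorphism (`mono_isoι`), through which a generalized morphism factors if and only if
it is invertible (`exists_comp_isoι_iff`).  So for `C = Cat` this is (isomorphic to) the
subcategory of `D.mor` of the horizontally invertible morphisms and squares. -/
noncomputable abbrev isoObj (D : InternalCategory C) : C :=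
  equalizer
    (prod.lift (D.hcomp D.forth D.back D.backForth_tgt_src) (D.hcomp D.back D.forth D.backForth_src_tgt))
    (prod.lift (D.forth ≫ D.src ≫ D.one)
      (D.back ≫ D.src ≫ D.one))

/-- The inclusion of the object of isomorphisms into the object of morphisms. -/
noncomputable def isoι (D : InternalCategory C) : D.isoObj ⟶ D.mor :=
  equalizer.ι _ _ ≫ D.forth

/-- The universal inverse. -/
noncomputable def isoInv (D : InternalCategory C) : D.isoObj ⟶ D.mor :=
  equalizer.ι _ _ ≫ D.back

/-- The source of an isomorphism. -/
noncomputable def isoSrc (D : InternalCategory C) : D.isoObj ⟶ D.obj := D.isoι ≫ D.src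

/-- The target of an isomorphism. -/
noncomputable def isoTgt (D : InternalCategory C) : D.isoObj ⟶ D.obj := D.isoι ≫ D.tgt

theorem isInverse_iso (D : InternalCategory C) : D.IsInverse D.isoι D.isoInv := by
  have e := equalizer.condition
    (prod.lift (D.hcomp D.forth D.back D.backForth_tgt_src) (D.hcomp D.back D.forth D.backForth_src_tgt))
    (prod.lift (D.forth ≫ D.src ≫ D.one)
      (D.back ≫ D.src ≫ D.one))
  have e₁ := congr($e ≫ prod.fst)
  have e₂ := congr($e ≫ prod.snd)
  simp only [Category.assoc, prod.lift_fst, prod.lift_snd] at e₁ e₂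
  have t₁ : D.isoι ≫ D.tgt = D.isoInv ≫ D.src := by
    rw [isoι, isoInv, Category.assoc, D.backForth_tgt_src, Category.assoc]
  have t₂ : D.isoInv ≫ D.tgt = D.isoι ≫ D.src := by
    rw [isoι, isoInv, Category.assoc, D.backForth_src_tgt, Category.assoc]
  refine ⟨t₁, t₂, ?_, ?_⟩
  · refine Eq.trans ?_ (e₁.trans (Category.assoc _ _ _).symm)
    exact (comp_hcomp D _ _ _ D.backForth_tgt_src t₁).symm
  · refine Eq.trans ?_ (e₂.trans (Category.assoc _ _ _).symm)
    exact (comp_hcomp D _ _ _ D.backForth_src_tgt t₂).symm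

/-- The morphism to the object of isomorphisms given by an invertible generalized morphism. -/
noncomputable def isoLift (D : InternalCategory C) {X : C} {f g : X ⟶ D.mor}
    (h : D.IsInverse f g) : X ⟶ D.isoObj :=
  equalizer.lift
    (pullback.lift f g (by ext <;> simp [prod.lift_fst, prod.lift_snd, h.tgt_src, h.src_tgt]))
    (by
      have p : ∀ (q : f ≫ prod.lift D.src D.tgt = g ≫ prod.lift D.tgt D.src),
          (pullback.lift f g q ≫ pullback.fst _ _) ≫ D.tgt =
            (pullback.lift f g q ≫ pullback.snd _ _) ≫ D.src := by
        intro q; simp [pullback.lift_fst, pullback.lift_snd, h.tgt_src]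
      have p' : ∀ (q : f ≫ prod.lift D.src D.tgt = g ≫ prod.lift D.tgt D.src),
          (pullback.lift f g q ≫ pullback.snd _ _) ≫ D.tgt =
            (pullback.lift f g q ≫ pullback.fst _ _) ≫ D.src := by
        intro q; simp [pullback.lift_fst, pullback.lift_snd, h.src_tgt]
      ext
      · simp only [Category.assoc, prod.lift_fst]
        rw [comp_hcomp D _ _ _ D.backForth_tgt_src (p _)]
        simpa [pullback.lift_fst, pullback.lift_snd, pullback.lift_fst_assoc, pullback.lift_snd_assoc] using h.hom_inv
      · simp only [Category.assoc, prod.lift_snd]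
        rw [comp_hcomp D _ _ _ D.backForth_src_tgt (p' _)]
        simpa [pullback.lift_fst, pullback.lift_snd, pullback.lift_fst_assoc, pullback.lift_snd_assoc] using h.inv_hom)

@[simp]
theorem isoLift_isoι (D : InternalCategory C) {X : C} {f g : X ⟶ D.mor}
    (h : D.IsInverse f g) : D.isoLift h ≫ D.isoι = f := by
  simp [isoLift, isoι, forth, pullback.lift_fst]

theorem mono_isoι (D : InternalCategory C) : Mono D.isoι where
  right_cancellation {X} a b e := by
    have e' : a ≫ D.isoInv = b ≫ D.isoInv :=
      (D.isInverse_iso.precomp a).unique (by rw [e]; exact D.isInverse_iso.precomp b)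
    apply equalizer.hom_ext
    apply pullback.hom_ext
    · simpa [isoι] using e
    · simpa [isoInv] using e'

theorem exists_comp_isoι_iff (D : InternalCategory C) {X : C} (f : X ⟶ D.mor) :
    (∃ l : X ⟶ D.isoObj, l ≫ D.isoι = f) ↔ ∃ g, D.IsInverse f g := by
  constructor
  · rintro ⟨l, rfl⟩
    exact ⟨_, D.isInverse_iso.precomp l⟩
  · rintro ⟨g, h⟩
    exact ⟨D.isoLift h, D.isoLift_isoι h⟩

/-- The morphism between objects of isomorphisms induced by an internal functor. -/
noncomputable def isoMap {D E : InternalCategory C} (F : D ⟶ E) : D.isoObj ⟶ E.isoObj :=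
  E.isoLift (D.isInverse_iso.map F)

theorem isoMap_isoTgt {D E : InternalCategory C} (F : D ⟶ E) :
    isoMap F ≫ E.isoTgt = D.isoTgt ≫ F.obj := by
  rw [isoMap, isoTgt, ← Category.assoc, isoLift_isoι, Category.assoc, F.tgt, isoTgt, Category.assoc]

/-- The mapping path object of `F : D ⟶ E`: pairs of an object `a` of `D` and an isomorphism
`b ≅ F a` of `E`. -/
noncomputable abbrev pathObj {D E : InternalCategory C} (F : D ⟶ E) : C :=
  pullback F.obj E.isoTgt

/-- The morphism sending `(a, b ≅ F a)` to `b`. -/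
noncomputable def pathSrc {D E : InternalCategory C} (F : D ⟶ E) : pathObj F ⟶ E.obj :=
  pullback.snd F.obj E.isoTgt ≫ E.isoSrc

/-- The comparison morphism sending an isomorphism `e' ≅ e` of `D` to `(e, F e' ≅ F e)`. -/
noncomputable def isoToPath {D E : InternalCategory C} (F : D ⟶ E) : D.isoObj ⟶ pathObj F :=
  pullback.lift D.isoTgt (isoMap F) (isoMap_isoTgt F).symm

/-- An internal functor is fully faithful if the square formed by the sources and targets is a
pullback square. -/
def FullyFaithful {D E : InternalCategory C} (F : D ⟶ E) : Prop :=
  IsPullback F.mor (prod.lift D.src D.tgt) (prod.lift E.src E.tgt) (prod.map F.obj F.obj)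

end Iso

end InternalCategory

/-! ### Notions relative to a Grothendieck topology -/

section Topology

variable {C : Type u} [Category.{v} C] (J : GrothendieckTopology C)

/-- A morphism is a `J`-epimorphism if the composite of the Yoneda embedding with sheafification
sends it to an epimorphism of sheaves.  As `C` may be large, sheaves take values in a universe for
which `C` is small. -/
def IsTopologyEpi {E B : C} (p : E ⟶ B) : Prop :=
  Epi ((uliftYoneda.{u, v, u} ⋙ presheafToSheaf J (Type (max u v))).map p)

/-- `P` is projective with respect to all `J`-epimorphisms. -/
def IsTopologyProjective (P : C) : Prop :=
  ∀ ⦃Q R : C⦄ (G : Q ⟶ R), IsTopologyEpi J G → ∀ H : P ⟶ R, ∃ F : P ⟶ Q, F ≫ G = H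

/-- There are enough `J`-projectives. -/
def EnoughTopologyProjectives : Prop :=
  ∀ X : C, ∃ (P : C) (p : P ⟶ X), IsTopologyProjective J P ∧ IsTopologyEpi J p

namespace InternalCategory

variable [HasFiniteLimits C]

/-- `F` is essentially `J`-surjective. -/
def EssentiallySurjective {D E : InternalCategory C} (F : D ⟶ E) : Prop :=
  IsTopologyEpi J (pathSrc F)

/-- The `J`-equivalences. -/
def we : MorphismProperty (InternalCategory C) :=
  fun _ _ F => FullyFaithful F ∧ EssentiallySurjective J F

/-- The `J`-fibrations. -/
def fib : MorphismProperty (InternalCategory C) :=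
  fun _ _ F => IsTopologyEpi J (isoToPath F)

/-- The `J`-cofibrations: the internal functors with the left lifting property with respect to
the `J`-fibrations that are `J`-equivalences. -/
def cof : MorphismProperty (InternalCategory C) :=
  (we J ⊓ fib J).llp

end InternalCategory

end Topology

/-! ### Double categories and the categorically surjective topology -/

/-- The category of small double categories and double functors.  For `D : DblCat`, the category
`D.obj` consists of the objects and vertical morphisms and `D.mor` of the horizontal morphisms and
squares. -/
abbrev DblCat : Type (u + 1) := InternalCategory Cat.{u, u}

/-- A functor is categorically surjective if it is surjective on objects and full. -/
def CategoricallySurjective {A B : Cat.{u, u}} (F : A ⟶ B) : Prop :=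
  Function.Surjective F.toFunctor.obj ∧ F.toFunctor.Full

/-- The category of pairs of objects, and of morphisms, with the same image. -/
structure MatchingPair {A B X : Type u} [Category.{u} A] [Category.{u} B] [Category.{u} X]
    (F : A ⥤ B) (G : X ⥤ B) : Type u where
  fst : A
  snd : X
  w : F.obj fst = G.obj snd

namespace MatchingPair

variable {A B X : Type u} [Category.{u} A] [Category.{u} B] [Category.{u} X]
  (F : A ⥤ B) (G : X ⥤ B)

instance : Category.{u} (MatchingPair F G) where
  Hom p q := {m : (p.fst ⟶ q.fst) × (p.snd ⟶ q.snd) //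
    F.map m.1 = eqToHom p.w ≫ G.map m.2 ≫ eqToHom q.w.symm}
  id p := ⟨(𝟙 _, 𝟙 _), by simp⟩
  comp m n := ⟨(m.1.1 ≫ n.1.1, m.1.2 ≫ n.1.2), by simp [m.2, n.2]⟩
  id_comp m := Subtype.ext (Prod.ext (Category.id_comp _) (Category.id_comp _))
  comp_id m := Subtype.ext (Prod.ext (Category.comp_id _) (Category.comp_id _))
  assoc m n k := Subtype.ext (Prod.ext (Category.assoc _ _ _) (Category.assoc _ _ _))

/-- The first projection. -/
def π₁ : MatchingPair F G ⥤ A where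
  obj p := p.fst
  map m := m.1.1

/-- The second projection. -/
def π₂ : MatchingPair F G ⥤ X where
  obj p := p.snd
  map m := m.1.2

theorem π₁_comp : π₁ F G ⋙ F = π₂ F G ⋙ G :=
  CategoryTheory.Functor.ext (fun p => p.w) (fun _ _ m => m.2)

end MatchingPair

theorem Cat.pullback_obj_ext {A B X : Cat.{u, u}} (F : A ⟶ B) (G : X ⟶ B)
    {p q : (pullback F G : Cat.{u, u})}
    (h₁ : (pullback.fst F G).toFunctor.obj p = (pullback.fst F G).toFunctor.obj q)
    (h₂ : (pullback.snd F G).toFunctor.obj p = (pullback.snd F G).toFunctor.obj q) : p = q := by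
  let c (x : (pullback F G : Cat.{u, u})) : Cat.of (Discrete PUnit.{u + 1}) ⟶ pullback F G :=
    Functor.toCatHom ((Functor.const _).obj x)
  have e : c p = c q := by
    apply pullback.hom_ext
    · apply Cat.Hom.ext
      refine CategoryTheory.Functor.ext (fun _ => h₁) (fun _ _ _ => ?_)
      change (pullback.fst F G).toFunctor.map (𝟙 p) =
        _ ≫ (pullback.fst F G).toFunctor.map (𝟙 q) ≫ _
      simp
    · apply Cat.Hom.ext
      refine CategoryTheory.Functor.ext (fun _ => h₂) (fun _ _ _ => ?_)
      change (pullback.snd F G).toFunctor.map (𝟙 p) =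
        _ ≫ (pullback.snd F G).toFunctor.map (𝟙 q) ≫ _
      simp
  exact congr(($e).toFunctor.obj ⟨PUnit.unit⟩)

theorem CategoricallySurjective.pullback_snd {A B X : Cat.{u, u}} {F : A ⟶ B}
    (hF : CategoricallySurjective F) (G : X ⟶ B) :
    CategoricallySurjective (pullback.snd F G) := by
  let M := MatchingPair F.toFunctor G.toFunctor
  let L : Cat.of M ⟶ pullback F G :=
    pullback.lift (Functor.toCatHom (MatchingPair.π₁ _ _)) (Functor.toCatHom (MatchingPair.π₂ _ _))
      (Cat.Hom.ext (MatchingPair.π₁_comp _ _))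
  have e₁ : L.toFunctor ⋙ (pullback.fst F G).toFunctor = MatchingPair.π₁ _ _ :=
    congrArg Cat.Hom.toFunctor (show L ≫ pullback.fst F G = _ from pullback.lift_fst _ _ _)
  have e₂ : L.toFunctor ⋙ (pullback.snd F G).toFunctor = MatchingPair.π₂ _ _ :=
    congrArg Cat.Hom.toFunctor (show L ≫ pullback.snd F G = _ from pullback.lift_snd _ _ _)
  refine ⟨fun x => ?_, ⟨fun {p q} j => ?_⟩⟩
  · obtain ⟨a, ha⟩ := hF.1 (G.toFunctor.obj x)
    exact ⟨L.toFunctor.obj ⟨a, x, ha⟩, Functor.congr_obj e₂ _⟩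
  · have w : ∀ r : (pullback F G : Cat.{u, u}),
        F.toFunctor.obj ((pullback.fst F G).toFunctor.obj r) =
          G.toFunctor.obj ((pullback.snd F G).toFunctor.obj r) := fun r =>
      congr(($(pullback.condition (f := F) (g := G))).toFunctor.obj r)
    let m (r : (pullback F G : Cat.{u, u})) : M := ⟨_, _, w r⟩
    have hm : ∀ r, L.toFunctor.obj (m r) = r := fun r =>
      Cat.pullback_obj_ext F G (Functor.congr_obj e₁ (m r)) (Functor.congr_obj e₂ (m r))
    have := hF.2
    obtain ⟨k, hk⟩ := F.toFunctor.map_surjective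
      (eqToHom (w p) ≫ G.toFunctor.map j ≫ eqToHom (w q).symm)
    let n : m p ⟶ m q := ⟨(k, j), hk⟩
    refine ⟨eqToHom (hm p).symm ≫ L.toFunctor.map n ≫ eqToHom (hm q), ?_⟩
    have key : (pullback.snd F G).toFunctor.map (L.toFunctor.map n) =
        eqToHom (Functor.congr_obj e₂ (m p)) ≫ j ≫ eqToHom (Functor.congr_obj e₂ (m q)).symm :=
      Functor.congr_hom e₂ n
    rw [Functor.map_comp, Functor.map_comp, key, eqToHom_map, eqToHom_map]
    have aux : ∀ {a b c d : X} (h₁ : a = c) (h₂ : c = a) (h₃ : b = d) (h₄ : d = b) (i : a ⟶ b),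
        eqToHom h₁ ≫ (eqToHom h₂ ≫ i ≫ eqToHom h₃) ≫ eqToHom h₄ = i := by
      intro a b c d h₁ h₂ h₃ h₄ i
      subst h₁ h₃
      simp
    exact aux _ _ _ _ j

/-- The basis in which a covering family is a single categorically surjective functor. -/
def categoricallySurjectiveBasis : Pretopology Cat.{u, u} where
  coverings X := {S | ∃ (Y : Cat.{u, u}) (F : Y ⟶ X),
    CategoricallySurjective F ∧ S = Presieve.singleton F}
  has_isos X Y F _ := by
    refine ⟨Y, F, ⟨fun x => ?_, ⟨fun {a b} j => ?_⟩⟩, rfl⟩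
    · exact ⟨(inv F).toFunctor.obj x, congr(($(IsIso.inv_hom_id F)).toFunctor.obj x)⟩
    · have : F.toFunctor.Full := (Cat.equivOfIso (asIso F)).full_functor
      exact F.toFunctor.map_surjective j
  pullbacks X Y G S := by
    rintro ⟨Z, F, hF, rfl⟩
    exact ⟨_, _, hF.pullback_snd G, Presieve.pullback_singleton _ _⟩
  transitive X S Ti := by
    rintro ⟨Y, F, hF, rfl⟩ hT
    obtain ⟨Z, G, hG, e⟩ := hT F ⟨⟩
    refine ⟨Z, G ≫ F, ⟨hF.1.comp hG.1, ?_⟩, ?_⟩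
    · have := hF.2
      have := hG.2
      exact inferInstanceAs (G.toFunctor ⋙ F.toFunctor).Full
    · funext W
      ext k
      constructor
      · rintro ⟨V, a, b, ⟨⟩, hb, rfl⟩
        rw [e] at hb
        obtain ⟨⟩ := hb
        exact ⟨⟩
      · rintro ⟨⟩
        exact ⟨_, G, F, ⟨⟩, by rw [e]; exact ⟨⟩, rfl⟩

/-- The categorically surjective topology on `Cat`: a sieve is covering if and only if it contains a
categorically surjective functor. -/
def tauPrime : GrothendieckTopology Cat.{u, u} :=
  categoricallySurjectiveBasis.toGrothendieck

/-- A small category is a free category on a (small) directed graph. -/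
def IsFreeOnGraph (P : Cat.{u, u}) : Prop :=
  ∃ G : Quiv.{u, u}, Nonempty (P ≅ Cat.free.obj G)

/-! Everything is tested on generalized elements. The morphisms from an object `P` to an internal
category `D` form an ordinary category, and when projectives are plentiful enough to detect
epimorphisms (`HasDetectingProjectives`), a morphism is `J`-epi exactly when it is surjective on
`P`-elements for every projective `P`. Hence the equivalences are the functors that are fully
faithful and essentially surjective on `P`-elements, and the fibrations are those that are
isofibrations on them (`essentiallySurjective_iff`, `fib_iff`). The proof of the canonical model
structure on ordinary categories then applies, with choice replaced by lifting out of projectives.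

The trivial fibrations are the fully faithful functors that are `J`-epi on objects
(`we_inf_fib_iff`), so being a cofibration is a condition on objects only (`cof_iff`). Both
factorizations add a projective summand to the objects of the source: a cover of the objects of the
target in one case, a cover of the mapping path object in the other. In the second case the functor
to the target is corrected by conjugation with a family of isomorphisms (`twist`). The remaining
lifting axiom is the retract argument.

For the categorically surjective topology, epimorphisms of sheaves are locally surjective maps, so a
functor is epi exactly when a categorically surjective functor factors through it. Free categories
lift along these, and the counit from the free category is one of them; the walking arrow detects
isomorphisms. Conversely a projective category is a retract of a free one. It inherits a length
function and common refinements of factorizations (`EquidivisibleLength`), and these force it to be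
free on its irreducible morphisms.

Limits of double categories are componentwise. Colimits come from the adjoint functor theorem:
formal terms in the double category operations bound the size of a generated sub double category
(`DblTerm.exists_sub`). -/

namespace InternalCategory

/-! ### Calculus of generalized elements -/

section Elements

variable {C : Type u} [Category.{v} C] [HasPullbacks C]

attribute [simp] one_src one_tgt

@[simp]
theorem one_src_assoc (D : InternalCategory C) {Z : C} (k : D.obj ⟶ Z) :
    D.one ≫ D.src ≫ k = k := by rw [← Category.assoc, D.one_src, Category.id_comp]

@[simp]
theorem one_tgt_assoc (D : InternalCategory C) {Z : C} (k : D.obj ⟶ Z) :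
    D.one ≫ D.tgt ≫ k = k := by rw [← Category.assoc, D.one_tgt, Category.id_comp]

@[simp]
theorem comp_obj {D E G : InternalCategory C} (F : D ⟶ E) (H : E ⟶ G) :
    (F ≫ H).obj = F.obj ≫ H.obj := rfl

@[simp]
theorem comp_mor {D E G : InternalCategory C} (F : D ⟶ E) (H : E ⟶ G) :
    (F ≫ H).mor = F.mor ≫ H.mor := rfl

@[simp]
theorem id_obj (D : InternalCategory C) : Hom.obj (𝟙 D) = 𝟙 D.obj := rfl

@[simp]
theorem id_mor (D : InternalCategory C) : Hom.mor (𝟙 D) = 𝟙 D.mor := rfl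

theorem hom_ext {D E : InternalCategory C} {F G : D ⟶ E} (h : F.obj = G.obj)
    (h' : F.mor = G.mor) : F = G := Hom.ext h h'

@[simp]
theorem map_src {D E : InternalCategory C} (F : D ⟶ E) : F.mor ≫ E.src = D.src ≫ F.obj := F.src

@[simp]
theorem map_src_assoc {D E : InternalCategory C} (F : D ⟶ E) {Z : C} (k : E.obj ⟶ Z) :
    F.mor ≫ E.src ≫ k = D.src ≫ F.obj ≫ k := by
  rw [← Category.assoc, map_src, Category.assoc]

@[simp]
theorem map_tgt {D E : InternalCategory C} (F : D ⟶ E) : F.mor ≫ E.tgt = D.tgt ≫ F.obj := F.tgt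

@[simp]
theorem map_tgt_assoc {D E : InternalCategory C} (F : D ⟶ E) {Z : C} (k : E.obj ⟶ Z) :
    F.mor ≫ E.tgt ≫ k = D.tgt ≫ F.obj ≫ k := by
  rw [← Category.assoc, map_tgt, Category.assoc]

@[simp]
theorem map_one {D E : InternalCategory C} (F : D ⟶ E) : D.one ≫ F.mor = F.obj ≫ E.one := F.one

open Classical in
/-- The composite (in diagrammatic order) of two generalized morphisms, equal to the first one if
they are not composable. -/
noncomputable def mul (D : InternalCategory C) {X : C} (f g : X ⟶ D.mor) : X ⟶ D.mor :=
  if h : f ≫ D.tgt = g ≫ D.src then D.hcomp f g h else f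

theorem mul_eq_hcomp (D : InternalCategory C) {X : C} {f g : X ⟶ D.mor}
    (h : f ≫ D.tgt = g ≫ D.src) : D.mul f g = D.hcomp f g h := dif_pos h

/-- No composability is assumed: on other pairs `mul` returns its first argument, which has the
right source. The companion `mul_tgt` does need it. -/
theorem mul_src (D : InternalCategory C) {X : C} (f g : X ⟶ D.mor) :
    D.mul f g ≫ D.src = f ≫ D.src := by
  unfold mul
  split_ifs with h
  · rw [hcomp, Category.assoc, D.comp_src, pullback.lift_fst_assoc]
  · rfl

theorem mul_src_assoc (D : InternalCategory C) {X Z : C} (f g : X ⟶ D.mor) (k : D.obj ⟶ Z) :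
    D.mul f g ≫ D.src ≫ k = f ≫ D.src ≫ k := by
  rw [← Category.assoc, mul_src, Category.assoc]

theorem mul_tgt (D : InternalCategory C) {X : C} {f g : X ⟶ D.mor}
    (h : f ≫ D.tgt = g ≫ D.src) : D.mul f g ≫ D.tgt = g ≫ D.tgt := by
  rw [mul_eq_hcomp D h, hcomp, Category.assoc, D.comp_tgt, pullback.lift_snd_assoc]

/-- Composability is required because `k ≫ f` and `k ≫ g` may be composable when `f` and `g` are
not. -/
theorem comp_mul (D : InternalCategory C) {X Y : C} (k : Y ⟶ X) {f g : X ⟶ D.mor}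
    (h : f ≫ D.tgt = g ≫ D.src) : k ≫ D.mul f g = D.mul (k ≫ f) (k ≫ g) := by
  have h' : (k ≫ f) ≫ D.tgt = (k ≫ g) ≫ D.src := by simp [h]
  rw [mul_eq_hcomp D h, mul_eq_hcomp D h', comp_hcomp]

theorem mul_map {D E : InternalCategory C} (F : D ⟶ E) {X : C} {f g : X ⟶ D.mor}
    (h : f ≫ D.tgt = g ≫ D.src) : D.mul f g ≫ F.mor = E.mul (f ≫ F.mor) (g ≫ F.mor) := by
  have h' : (f ≫ F.mor) ≫ E.tgt = (g ≫ F.mor) ≫ E.src := by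
    simp only [Category.assoc, map_src, map_tgt, reassoc_of% h]
  rw [mul_eq_hcomp D h, mul_eq_hcomp E h', hcomp_map]

theorem mul_assoc (D : InternalCategory C) {X : C} {f g h : X ⟶ D.mor}
    (hfg : f ≫ D.tgt = g ≫ D.src) (hgh : g ≫ D.tgt = h ≫ D.src) :
    D.mul (D.mul f g) h = D.mul f (D.mul g h) := by
  have h₁ : D.mul f g ≫ D.tgt = h ≫ D.src := by rw [mul_tgt D hfg, hgh]
  have h₂ : f ≫ D.tgt = D.mul g h ≫ D.src := by rw [mul_src, hfg]
  rw [mul_eq_hcomp D h₁, mul_eq_hcomp D h₂]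
  simp only [mul_eq_hcomp D hfg, mul_eq_hcomp D hgh]
  exact D.assoc f g h hfg hgh _ _

theorem one_mul (D : InternalCategory C) {X : C} {a : X ⟶ D.obj} {f : X ⟶ D.mor}
    (h : a = f ≫ D.src) : D.mul (a ≫ D.one) f = f := by
  subst h
  rw [mul_eq_hcomp D (by simp), hcomp]
  simp only [Category.assoc]
  exact D.one_comp f (by simp)

theorem mul_one (D : InternalCategory C) {X : C} {a : X ⟶ D.obj} {f : X ⟶ D.mor}
    (h : f ≫ D.tgt = a) : D.mul f (a ≫ D.one) = f := by
  subst h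
  rw [mul_eq_hcomp D (by simp), hcomp]
  simp only [Category.assoc]
  exact D.comp_one f (by simp)

theorem isInverse_iff (D : InternalCategory C) {X : C} {f g : X ⟶ D.mor} :
    D.IsInverse f g ↔ f ≫ D.tgt = g ≫ D.src ∧ g ≫ D.tgt = f ≫ D.src ∧
      D.mul f g = f ≫ D.src ≫ D.one ∧ D.mul g f = g ≫ D.src ≫ D.one := by
  constructor
  · rintro ⟨h₁, h₂, h₃, h₄⟩
    exact ⟨h₁, h₂, by rw [mul_eq_hcomp D h₁, h₃], by rw [mul_eq_hcomp D h₂, h₄]⟩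
  · rintro ⟨h₁, h₂, h₃, h₄⟩
    exact ⟨h₁, h₂, by rw [← mul_eq_hcomp D h₁, h₃], by rw [← mul_eq_hcomp D h₂, h₄]⟩

theorem IsInverse.symm {D : InternalCategory C} {X : C} {f g : X ⟶ D.mor}
    (h : D.IsInverse f g) : D.IsInverse g f := ⟨h.2, h.1, h.4, h.3⟩

theorem IsInverse.mul_eq {D : InternalCategory C} {X : C} {f g : X ⟶ D.mor}
    (h : D.IsInverse f g) : D.mul f g = f ≫ D.src ≫ D.one := (D.isInverse_iff.1 h).2.2.1

theorem IsInverse.mul_mul_cancel {D : InternalCategory C} {X : C} {f g : X ⟶ D.mor}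
    (h : D.IsInverse f g) {k : X ⟶ D.mor} (hk : g ≫ D.tgt = k ≫ D.src) :
    D.mul f (D.mul g k) = k := by
  rw [← mul_assoc D h.tgt_src hk, h.mul_eq, ← Category.assoc]
  exact one_mul D (by rw [← hk, h.src_tgt])

theorem isInverse_one (D : InternalCategory C) {X : C} (a : X ⟶ D.obj) :
    D.IsInverse (a ≫ D.one) (a ≫ D.one) := by
  rw [isInverse_iff]
  have : D.mul (a ≫ D.one) (a ≫ D.one) = a ≫ D.one := one_mul D (by simp)
  simp [this]

theorem IsInverse.mul {D : InternalCategory C} {X : C} {f f' g g' : X ⟶ D.mor}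
    (hf : D.IsInverse f f') (hg : D.IsInverse g g') (h : f ≫ D.tgt = g ≫ D.src) :
    D.IsInverse (D.mul f g) (D.mul g' f') := by
  have h' : g' ≫ D.tgt = f' ≫ D.src := by rw [hg.src_tgt, ← h, hf.tgt_src]
  rw [isInverse_iff]
  refine ⟨?_, ?_, ?_, ?_⟩
  · rw [mul_tgt D h, mul_src, hg.tgt_src]
  · rw [mul_tgt D h', mul_src, hf.src_tgt]
  · rw [mul_assoc D h (by rw [mul_src, hg.tgt_src]), hg.mul_mul_cancel h', hf.mul_eq, mul_src_assoc]
  · rw [mul_assoc D h' (by rw [mul_src, hf.src_tgt]), hf.symm.mul_mul_cancel h, hg.symm.mul_eq,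
      mul_src_assoc]

variable (C) in
/-- An internal category presented by its composition operation on generalized elements. -/
structure Presentation where
  /-- the object of objects -/
  obj : C
  /-- the object of morphisms -/
  mor : C
  /-- source -/
  src : mor ⟶ obj
  /-- target -/
  tgt : mor ⟶ obj
  /-- identities -/
  one : obj ⟶ mor
  /-- composition of generalized elements -/
  comp : ∀ {X : C} (f g : X ⟶ mor), f ≫ tgt = g ≫ src → (X ⟶ mor)
  comp_nat : ∀ {X Y : C} (k : Y ⟶ X) (f g : X ⟶ mor) (h : f ≫ tgt = g ≫ src)
    (h' : (k ≫ f) ≫ tgt = (k ≫ g) ≫ src), k ≫ comp f g h = comp (k ≫ f) (k ≫ g) h'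
  one_src : one ≫ src = 𝟙 obj
  one_tgt : one ≫ tgt = 𝟙 obj
  comp_src : ∀ {X : C} (f g : X ⟶ mor) (h : f ≫ tgt = g ≫ src), comp f g h ≫ src = f ≫ src
  comp_tgt : ∀ {X : C} (f g : X ⟶ mor) (h : f ≫ tgt = g ≫ src), comp f g h ≫ tgt = g ≫ tgt
  one_comp : ∀ {X : C} (f : X ⟶ mor) (h : (f ≫ src ≫ one) ≫ tgt = f ≫ src),
    comp (f ≫ src ≫ one) f h = f
  comp_one : ∀ {X : C} (f : X ⟶ mor) (h : f ≫ tgt = (f ≫ tgt ≫ one) ≫ src),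
    comp f (f ≫ tgt ≫ one) h = f
  assoc : ∀ {X : C} (f g h : X ⟶ mor) (hfg : f ≫ tgt = g ≫ src) (hgh : g ≫ tgt = h ≫ src)
    (h₁ : comp f g hfg ≫ tgt = h ≫ src) (h₂ : f ≫ tgt = comp g h hgh ≫ src),
    comp (comp f g hfg) h h₁ = comp f (comp g h hgh) h₂

/-- The two projections form the universal composable pair, and `comp_nat` along `pullback.lift f g
h` yields every other pair. This Yoneda argument lets an operation on generalized elements define a
composition morphism. -/
theorem Presentation.lift_comp (S : Presentation C) {X : C} (f g : X ⟶ S.mor)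
    (h : f ≫ S.tgt = g ≫ S.src) :
    pullback.lift f g h ≫
      S.comp (pullback.fst S.tgt S.src) (pullback.snd S.tgt S.src) pullback.condition =
        S.comp f g h := by
  rw [S.comp_nat _ _ _ _ (by simp [pullback.condition])]
  congr 1
  · simp [pullback.lift_fst]
  · simp [pullback.lift_snd]

/-- The internal category with a given presentation. -/
noncomputable def Presentation.toCat (S : Presentation C) : InternalCategory C where
  obj := S.obj
  mor := S.mor
  src := S.src
  tgt := S.tgt
  one := S.one
  comp := S.comp (pullback.fst S.tgt S.src) (pullback.snd S.tgt S.src) pullback.condition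
  one_src := S.one_src
  one_tgt := S.one_tgt
  comp_src := S.comp_src _ _ _
  comp_tgt := S.comp_tgt _ _ _
  one_comp f h := by rw [S.lift_comp, S.one_comp]
  comp_one f h := by rw [S.lift_comp, S.comp_one]
  assoc f g h hfg hgh h₁ h₂ := by
    simp only [S.lift_comp] at h₁ h₂ ⊢
    exact S.assoc f g h hfg hgh h₁ h₂

theorem Presentation.mul_toCat (S : Presentation C) {X : C} {f g : X ⟶ S.mor}
    (h : f ≫ S.tgt = g ≫ S.src) : S.toCat.mul f g = S.comp f g h := by
  rw [mul_eq_hcomp S.toCat h]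
  exact S.lift_comp f g h

/-- An internal functor from its effect on generalized elements. -/
def homOfElements {D E : InternalCategory C} (obj : D.obj ⟶ E.obj) (mor : D.mor ⟶ E.mor)
    (src : mor ≫ E.src = D.src ≫ obj) (tgt : mor ≫ E.tgt = D.tgt ≫ obj)
    (one : D.one ≫ mor = obj ≫ E.one)
    (comp : ∀ {X : C} (f g : X ⟶ D.mor), f ≫ D.tgt = g ≫ D.src →
      D.mul f g ≫ mor = E.mul (f ≫ mor) (g ≫ mor)) : D ⟶ E where
  obj := obj
  mor := mor
  src := src
  tgt := tgt
  one := one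
  comp := by
    have h : pullback.fst D.tgt D.src ≫ D.tgt = pullback.snd D.tgt D.src ≫ D.src :=
      pullback.condition
    have h' : (pullback.fst D.tgt D.src ≫ mor) ≫ E.tgt = (pullback.snd D.tgt D.src ≫ mor) ≫
        E.src := by
      simp only [Category.assoc, src, tgt, reassoc_of% h]
    -- The composition morphism is the value of `mul` at the universal composable pair, so the
    -- hypothesis on generalized elements applies to it.
    have e : D.comp = D.mul (pullback.fst D.tgt D.src) (pullback.snd D.tgt D.src) := by
      rw [mul_eq_hcomp D h, hcomp]
      nth_rw 1 [← Category.id_comp D.comp]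
      congr 1
      apply pullback.hom_ext
      · simp
      · simp
    rw [e, comp _ _ h, mul_eq_hcomp E h', hcomp]

end Elements

end InternalCategory

namespace InternalCategory

/-! ### Limits of internal categories -/

section Limits

universe w w'

variable (C : Type u) [Category.{v} C] [HasPullbacks C]

/-- The functor sending an internal category to its object of objects. -/
def objFunctor : InternalCategory C ⥤ C where
  obj D := D.obj
  map F := F.obj

/-- The functor sending an internal category to its object of morphisms. -/
def morFunctor : InternalCategory C ⥤ C where
  obj D := D.mor
  map F := F.mor

variable {C} {J : Type w} [Category.{w'} J] [HasLimitsOfShape J C] (K : J ⥤ InternalCategory C)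

/-- The limit of the objects of objects. -/
noncomputable def limObj : C := limit (K ⋙ objFunctor C)

/-- The limit of the objects of morphisms. -/
noncomputable def limMor : C := limit (K ⋙ morFunctor C)

/-- The projections of the limit of the objects of objects. -/
noncomputable def objπ (j : J) : limObj K ⟶ (K.obj j).obj := limit.π (K ⋙ objFunctor C) j

/-- The projections of the limit of the objects of morphisms. -/
noncomputable def morπ (j : J) : limMor K ⟶ (K.obj j).mor := limit.π (K ⋙ morFunctor C) j

@[simp]
theorem objπ_map {j j' : J} (a : j ⟶ j') : objπ K j ≫ (K.map a).obj = objπ K j' :=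
  limit.w (K ⋙ objFunctor C) a

@[simp]
theorem morπ_map {j j' : J} (a : j ⟶ j') : morπ K j ≫ (K.map a).mor = morπ K j' :=
  limit.w (K ⋙ morFunctor C) a

@[simp]
theorem objπ_map_assoc {j j' : J} (a : j ⟶ j') {Z : C} (k : (K.obj j').obj ⟶ Z) :
    objπ K j ≫ (K.map a).obj ≫ k = objπ K j' ≫ k := by rw [← Category.assoc, objπ_map]

theorem morπ_map_assoc {j j' : J} (a : j ⟶ j') {Z : C} (k : (K.obj j').mor ⟶ Z) :
    morπ K j ≫ (K.map a).mor ≫ k = morπ K j' ≫ k := by rw [← Category.assoc, morπ_map]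

theorem limObj_hom_ext {X : C} {f g : X ⟶ limObj K} (h : ∀ j, f ≫ objπ K j = g ≫ objπ K j) :
    f = g :=
  limit.hom_ext (F := K ⋙ objFunctor C) h

theorem limMor_hom_ext {X : C} {f g : X ⟶ limMor K} (h : ∀ j, f ≫ morπ K j = g ≫ morπ K j) :
    f = g :=
  limit.hom_ext (F := K ⋙ morFunctor C) h

/-- The morphism to the limit of the objects of objects. -/
noncomputable def liftObj {X : C} (f : ∀ j, X ⟶ (K.obj j).obj)
    (h : ∀ (j j' : J) (a : j ⟶ j'), f j ≫ (K.map a).obj = f j') : X ⟶ limObj K :=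
  limit.lift (K ⋙ objFunctor C) ⟨X, .mk f (fun _ _ a => (Category.id_comp _).trans (h _ _ a).symm)⟩

/-- The morphism to the limit of the objects of morphisms. -/
noncomputable def liftMor {X : C} (f : ∀ j, X ⟶ (K.obj j).mor)
    (h : ∀ (j j' : J) (a : j ⟶ j'), f j ≫ (K.map a).mor = f j') : X ⟶ limMor K :=
  limit.lift (K ⋙ morFunctor C) ⟨X, .mk f (fun _ _ a => (Category.id_comp _).trans (h _ _ a).symm)⟩

variable {K}

@[simp]
theorem liftObj_π {X : C} (f : ∀ j, X ⟶ (K.obj j).obj)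
    (h : ∀ (j j' : J) (a : j ⟶ j'), f j ≫ (K.map a).obj = f j') (j : J) :
    liftObj K f h ≫ objπ K j = f j := limit.lift_π _ _

@[simp]
theorem liftMor_π {X : C} (f : ∀ j, X ⟶ (K.obj j).mor)
    (h : ∀ (j j' : J) (a : j ⟶ j'), f j ≫ (K.map a).mor = f j') (j : J) :
    liftMor K f h ≫ morπ K j = f j := limit.lift_π _ _

@[simp]
theorem liftMor_π_assoc {X Z : C} (f : ∀ j, X ⟶ (K.obj j).mor)
    (h : ∀ (j j' : J) (a : j ⟶ j'), f j ≫ (K.map a).mor = f j') (j : J)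
    (k : (K.obj j).mor ⟶ Z) :
    liftMor K f h ≫ morπ K j ≫ k = f j ≫ k := by rw [← Category.assoc, liftMor_π]

@[simp]
theorem liftObj_π_assoc {X Z : C} (f : ∀ j, X ⟶ (K.obj j).obj)
    (h : ∀ (j j' : J) (a : j ⟶ j'), f j ≫ (K.map a).obj = f j') (j : J)
    (k : (K.obj j).obj ⟶ Z) :
    liftObj K f h ≫ objπ K j ≫ k = f j ≫ k := by rw [← Category.assoc, liftObj_π]

variable (K)

/-- The source morphism of the limit. -/
noncomputable def limSrc : limMor K ⟶ limObj K :=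
  liftObj K (fun j => morπ K j ≫ (K.obj j).src)
    (fun _ _ a => by rw [Category.assoc, ← map_src, morπ_map_assoc])

/-- The target morphism of the limit. -/
noncomputable def limTgt : limMor K ⟶ limObj K :=
  liftObj K (fun j => morπ K j ≫ (K.obj j).tgt)
    (fun _ _ a => by rw [Category.assoc, ← map_tgt, morπ_map_assoc])

@[simp]
theorem limSrc_π (j : J) : limSrc K ≫ objπ K j = morπ K j ≫ (K.obj j).src := by
  rw [limSrc, liftObj_π]

@[simp]
theorem limTgt_π (j : J) : limTgt K ≫ objπ K j = morπ K j ≫ (K.obj j).tgt := by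
  rw [limTgt, liftObj_π]

@[simp]
theorem limSrc_π_assoc (j : J) {Z : C} (k : (K.obj j).obj ⟶ Z) :
    limSrc K ≫ objπ K j ≫ k = morπ K j ≫ (K.obj j).src ≫ k := by
  rw [← Category.assoc, limSrc_π, Category.assoc]

@[simp]
theorem limTgt_π_assoc (j : J) {Z : C} (k : (K.obj j).obj ⟶ Z) :
    limTgt K ≫ objπ K j ≫ k = morπ K j ≫ (K.obj j).tgt ≫ k := by
  rw [← Category.assoc, limTgt_π, Category.assoc]

variable {K} in
theorem composable_π {X : C} {f g : X ⟶ limMor K} (h : f ≫ limTgt K = g ≫ limSrc K) (j : J) :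
    (f ≫ morπ K j) ≫ (K.obj j).tgt = (g ≫ morπ K j) ≫ (K.obj j).src := by
  simpa using congr($h ≫ objπ K j)

variable {K} in
/-- The composition of the limit on generalized elements. -/
noncomputable def limComp {X : C} (f g : X ⟶ limMor K) (h : f ≫ limTgt K = g ≫ limSrc K) :
    X ⟶ limMor K :=
  liftMor K (fun j => (K.obj j).mul (f ≫ morπ K j) (g ≫ morπ K j))
    (fun _ _ a => by rw [mul_map _ (composable_π h _)]; simp)

variable {K} in
theorem limComp_π {X : C} (f g : X ⟶ limMor K) (h : f ≫ limTgt K = g ≫ limSrc K) (j : J) :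
    limComp f g h ≫ morπ K j = (K.obj j).mul (f ≫ morπ K j) (g ≫ morπ K j) := liftMor_π _ _ _

/-- The identities of the limit. -/
noncomputable def limOne : limObj K ⟶ limMor K :=
  liftMor K (fun j => objπ K j ≫ (K.obj j).one) (fun _ _ a => by simp)

@[simp]
theorem limOne_π (j : J) : limOne K ≫ morπ K j = objπ K j ≫ (K.obj j).one := by
  rw [limOne, liftMor_π]

@[simp]
theorem limOne_π_assoc (j : J) {Z : C} (k : (K.obj j).mor ⟶ Z) :
    limOne K ≫ morπ K j ≫ k = objπ K j ≫ (K.obj j).one ≫ k := by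
  rw [← Category.assoc, limOne_π, Category.assoc]

/-- The presentation of the limit of a diagram of internal categories, computed componentwise. -/
noncomputable def limPresentation : Presentation C where
  obj := limObj K
  mor := limMor K
  src := limSrc K
  tgt := limTgt K
  one := limOne K
  comp := limComp
  comp_nat k f g h h' := limMor_hom_ext K fun j => by
    rw [Category.assoc, limComp_π, limComp_π, comp_mul _ _ (composable_π h j), Category.assoc,
      Category.assoc]
  one_src := limObj_hom_ext K fun j => by simp
  one_tgt := limObj_hom_ext K fun j => by simp
  comp_src f g h := limObj_hom_ext K fun j => by
    rw [Category.assoc, limSrc_π, ← Category.assoc, limComp_π, mul_src]; simp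
  comp_tgt f g h := limObj_hom_ext K fun j => by
    rw [Category.assoc, limTgt_π, ← Category.assoc, limComp_π, mul_tgt _ (composable_π h j)]
    simp
  one_comp f h := limMor_hom_ext K fun j => by
    rw [limComp_π]
    simpa using (K.obj j).one_mul (f := f ≫ morπ K j) rfl
  comp_one f h := limMor_hom_ext K fun j => by
    rw [limComp_π]
    simpa using (K.obj j).mul_one (f := f ≫ morπ K j) rfl
  assoc f g h hfg hgh h₁ h₂ := limMor_hom_ext K fun j => by
    simp only [limComp_π]
    exact mul_assoc _ (composable_π hfg j) (composable_π hgh j)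

/-- The limit of a diagram of internal categories. -/
noncomputable def limitCat : InternalCategory C := (limPresentation K).toCat

theorem mul_limitCat_π {X : C} {f g : X ⟶ limMor K} (h : f ≫ limTgt K = g ≫ limSrc K) (j : J) :
    (limitCat K).mul f g ≫ morπ K j = (K.obj j).mul (f ≫ morπ K j) (g ≫ morπ K j) :=
  (congrArg (· ≫ morπ K j) ((limPresentation K).mul_toCat h)).trans (limComp_π f g h j)

/-- The projections of the limit. -/
noncomputable def limitπ (j : J) : limitCat K ⟶ K.obj j :=
  homOfElements (objπ K j) (morπ K j) (limSrc_π K j).symm (limTgt_π K j).symm (limOne_π K j)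
    (fun _ _ h => mul_limitCat_π K h j)

/-- The limit cone. -/
noncomputable def limitCone : Cone K where
  pt := limitCat K
  π := .mk (limitπ K) (fun _ _ a => (Category.id_comp _).trans
    (hom_ext (objπ_map K a).symm (morπ_map K a).symm))

variable {K} in
omit [HasLimitsOfShape J C] in
theorem cone_w_obj (s : Cone K) (j j' : J) (a : j ⟶ j') :
    (s.π.app j).obj ≫ (K.map a).obj = (s.π.app j').obj := congrArg Hom.obj (s.w a)

variable {K} in
omit [HasLimitsOfShape J C] in
theorem cone_w_mor (s : Cone K) (j j' : J) (a : j ⟶ j') :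
    (s.π.app j).mor ≫ (K.map a).mor = (s.π.app j').mor := congrArg Hom.mor (s.w a)

/-- The morphism to the limit induced by a cone. -/
noncomputable def limitLift (s : Cone K) : s.pt ⟶ limitCat K :=
  homOfElements (liftObj K (fun j => (s.π.app j).obj) (cone_w_obj s))
      (liftMor K (fun j => (s.π.app j).mor) (cone_w_mor s))
    (limObj_hom_ext K fun j => by
      change (liftMor K _ (cone_w_mor s) ≫ limSrc K) ≫ objπ K j =
          (s.pt.src ≫ liftObj K _ (cone_w_obj s)) ≫ objπ K j
      simp)
    (limObj_hom_ext K fun j => by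
      change (liftMor K _ (cone_w_mor s) ≫ limTgt K) ≫ objπ K j =
          (s.pt.tgt ≫ liftObj K _ (cone_w_obj s)) ≫ objπ K j
      simp)
    (limMor_hom_ext K fun j => by
      change (s.pt.one ≫ liftMor K _ (cone_w_mor s)) ≫ morπ K j =
        (liftObj K _ (cone_w_obj s) ≫ limOne K) ≫ morπ K j
      simp)
    (fun f g h => limMor_hom_ext K fun j => by
      have h' : (f ≫ liftMor K (fun j => (s.π.app j).mor) (cone_w_mor s)) ≫ limTgt K =
          (g ≫ liftMor K (fun j => (s.π.app j).mor) (cone_w_mor s)) ≫ limSrc K :=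
        limObj_hom_ext K fun j => by simp [reassoc_of% h]
      refine .trans ?_ (mul_limitCat_π K h' j).symm
      rw [Category.assoc, Category.assoc, liftMor_π, ← mul_map _ h]
      exact (Category.assoc _ _ _).trans (by rw [liftMor_π]))

theorem limitLift_π (s : Cone K) (j : J) : limitLift K s ≫ limitπ K j = s.π.app j :=
  hom_ext (liftObj_π _ (cone_w_obj s) j) (liftMor_π _ (cone_w_mor s) j)

/-- The limit cone is a limit cone. -/
noncomputable def limitConeIsLimit : IsLimit (limitCone K) where
  lift := limitLift K
  fac := limitLift_π K
  uniq s _ h := hom_ext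
    (limObj_hom_ext K fun j => congrArg Hom.obj ((h j).trans (limitLift_π K s j).symm))
    (limMor_hom_ext K fun j => congrArg Hom.mor ((h j).trans (limitLift_π K s j).symm))

/-- The structure of an internal category is expressed by finite limits, which commute with limits;
so objects and morphisms are treated separately. -/
instance : HasLimitsOfShape J (InternalCategory C) where
  has_limit K := ⟨⟨⟨limitCone K, limitConeIsLimit K⟩⟩⟩

end Limits

instance {C : Type u} [Category.{v} C] [HasFiniteLimits C] :
    HasFiniteLimits (InternalCategory C) where
  out _ := inferInstance

instance {C : Type u} [Category.{v} C] [HasLimits C] :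
    HasLimits (InternalCategory C) where
  has_limits_of_shape _ := inferInstance

end InternalCategory

namespace InternalCategory

/-! ### Fully faithful functors, equivalences and fibrations on generalized elements -/

section

variable {C : Type u} [Category.{v} C] [HasFiniteLimits C]

theorem lift_pair_eq {D E : InternalCategory C} (F : D ⟶ E) {X : C} {a b : X ⟶ D.obj}
    {m : X ⟶ E.mor} (ha : m ≫ E.src = a ≫ F.obj) (hb : m ≫ E.tgt = b ≫ F.obj) :
    m ≫ prod.lift E.src E.tgt = prod.lift a b ≫ prod.map F.obj F.obj := by
  rw [prod.comp_lift, prod.lift_map, ha, hb]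

theorem FullyFaithful.exists_lift {D E : InternalCategory C} {F : D ⟶ E} (hF : FullyFaithful F)
    {X : C} {a b : X ⟶ D.obj} {m : X ⟶ E.mor} (ha : m ≫ E.src = a ≫ F.obj)
    (hb : m ≫ E.tgt = b ≫ F.obj) :
    ∃ n : X ⟶ D.mor, n ≫ D.src = a ∧ n ≫ D.tgt = b ∧ n ≫ F.mor = m := by
  refine ⟨hF.lift m (prod.lift a b) (lift_pair_eq F ha hb), ?_, ?_, hF.lift_fst _ _ _⟩
  · simpa [prod.lift_fst] using congr($(hF.lift_snd m (prod.lift a b) (lift_pair_eq F ha hb)) ≫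
      prod.fst)
  · simpa [prod.lift_snd] using congr($(hF.lift_snd m (prod.lift a b) (lift_pair_eq F ha hb)) ≫
      prod.snd)

theorem FullyFaithful.hom_ext {D E : InternalCategory C} {F : D ⟶ E} (hF : FullyFaithful F)
    {X : C} {m n : X ⟶ D.mor} (hs : m ≫ D.src = n ≫ D.src) (ht : m ≫ D.tgt = n ≫ D.tgt)
    (h : m ≫ F.mor = n ≫ F.mor) : m = n := by
  refine IsPullback.hom_ext hF h ?_
  ext <;> simp [prod.lift_fst, prod.lift_snd, hs, ht]

/-- An internal functor is fully faithful if it is so on generalized elements. -/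
theorem fullyFaithful_of_elements {D E : InternalCategory C} {F : D ⟶ E}
    (h₁ : ∀ {X : C} {a b : X ⟶ D.obj} {m : X ⟶ E.mor}, m ≫ E.src = a ≫ F.obj →
      m ≫ E.tgt = b ≫ F.obj → ∃ n : X ⟶ D.mor, n ≫ D.src = a ∧ n ≫ D.tgt = b ∧ n ≫ F.mor = m)
    (h₂ : ∀ {X : C} {m n : X ⟶ D.mor}, m ≫ D.src = n ≫ D.src → m ≫ D.tgt = n ≫ D.tgt →
      m ≫ F.mor = n ≫ F.mor → m = n) : FullyFaithful F := by
  have w {X : C} (m : X ⟶ E.mor) (p : X ⟶ D.obj ⨯ D.obj)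
      (w : m ≫ prod.lift E.src E.tgt = p ≫ prod.map F.obj F.obj) :
      ∃ n : X ⟶ D.mor, n ≫ D.src = p ≫ prod.fst ∧ n ≫ D.tgt = p ≫ prod.snd ∧ n ≫ F.mor = m := by
    refine h₁ ?_ ?_
    · simpa [prod.lift_fst, prod.map_fst] using congr($w ≫ prod.fst)
    · simpa [prod.lift_snd, prod.map_snd] using congr($w ≫ prod.snd)
  refine ⟨⟨lift_pair_eq F F.src F.tgt⟩, ⟨PullbackCone.IsLimit.mk _
    (fun s => (w s.fst s.snd s.condition).choose)
    (fun s => (w s.fst s.snd s.condition).choose_spec.2.2)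
    (fun s => ?_) (fun s m hm hm' => ?_)⟩⟩
  · have := (w s.fst s.snd s.condition).choose_spec
    ext
    · simpa [prod.lift_fst] using this.1
    · simpa [prod.lift_snd] using this.2.1
  · have := (w s.fst s.snd s.condition).choose_spec
    refine h₂ ?_ ?_ (hm.trans this.2.2.symm)
    · rw [this.1, ← hm']; simp [prod.lift_fst]
    · rw [this.2.1, ← hm']; simp [prod.lift_snd]

theorem FullyFaithful.comp {D E G : InternalCategory C} {F : D ⟶ E} {H : E ⟶ G}
    (hF : FullyFaithful F) (hH : FullyFaithful H) : FullyFaithful (F ≫ H) := by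
  refine fullyFaithful_of_elements (fun {X a b m} ha hb => ?_) (fun {X m n} hs ht h => ?_)
  · obtain ⟨n, h₁, h₂, h₃⟩ := hH.exists_lift (a := a ≫ F.obj) (b := b ≫ F.obj)
      (by simpa using ha) (by simpa using hb)
    obtain ⟨k, h₄, h₅, h₆⟩ := hF.exists_lift h₁ h₂
    exact ⟨k, h₄, h₅, by rw [comp_mor, ← Category.assoc, h₆, h₃]⟩
  · refine hF.hom_ext hs ht (hH.hom_ext ?_ ?_ ?_)
    · simp [reassoc_of% hs]
    · simp [reassoc_of% ht]
    · simpa using h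

/-- A morphism of `E` between images of `F` is pushed to `G` and lifted through `F ≫ H`;
faithfulness of `H` shows that the lift has the right image in `E`. -/
theorem FullyFaithful.of_comp {D E G : InternalCategory C} {F : D ⟶ E} {H : E ⟶ G}
    (hFH : FullyFaithful (F ≫ H)) (hH : FullyFaithful H) : FullyFaithful F := by
  refine fullyFaithful_of_elements (fun {X a b m} ha hb => ?_) (fun {X m n} hs ht h => ?_)
  · obtain ⟨n, h₁, h₂, h₃⟩ := hFH.exists_lift (a := a) (b := b) (m := m ≫ H.mor)
      (by simp [reassoc_of% ha]) (by simp [reassoc_of% hb])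
    refine ⟨n, h₁, h₂, hH.hom_ext ?_ ?_ ?_⟩
    · simp [ha, reassoc_of% h₁]
    · simp [hb, reassoc_of% h₂]
    · simpa using h₃
  · exact hFH.hom_ext hs ht (by simp [reassoc_of% h])

/-- The morphism and its inverse are lifted separately. The lifts are inverse to each other because
both sides of each equation agree in source, target and image. -/
theorem FullyFaithful.exists_inverse {D E : InternalCategory C} {F : D ⟶ E}
    (hF : FullyFaithful F) {X : C} {a b : X ⟶ D.obj} {m m' : X ⟶ E.mor} (hm : E.IsInverse m m')
    (ha : m ≫ E.src = a ≫ F.obj) (hb : m ≫ E.tgt = b ≫ F.obj) :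
    ∃ n n' : X ⟶ D.mor, D.IsInverse n n' ∧ n ≫ D.src = a ∧ n ≫ D.tgt = b ∧ n ≫ F.mor = m ∧
      n' ≫ F.mor = m' := by
  obtain ⟨n, h₁, h₂, h₃⟩ := hF.exists_lift ha hb
  obtain ⟨n', h₁', h₂', h₃'⟩ := hF.exists_lift (m := m') (hm.tgt_src.symm.trans hb)
    (hm.src_tgt.trans ha)
  have t₁ : n ≫ D.tgt = n' ≫ D.src := h₂.trans h₁'.symm
  have t₂ : n' ≫ D.tgt = n ≫ D.src := h₂'.trans h₁.symm
  refine ⟨n, n', ?_, h₁, h₂, h₃, h₃'⟩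
  rw [isInverse_iff]
  refine ⟨t₁, t₂, hF.hom_ext ?_ ?_ ?_, hF.hom_ext ?_ ?_ ?_⟩
  · simp [mul_src]
  · simp [mul_tgt D t₁, t₂]
  · rw [mul_map F t₁, h₃, h₃', hm.mul_eq]
    simp [reassoc_of% ha, reassoc_of% h₁]
  · simp [mul_src]
  · simp [mul_tgt D t₂, t₁]
  · rw [mul_map F t₂, h₃, h₃', hm.symm.mul_eq]
    simp [← reassoc_of% hm.tgt_src, reassoc_of% hb, reassoc_of% h₁']

/-- A functor on objects over a fully faithful functor extends uniquely. -/
theorem FullyFaithful.exists_hom {D E G : InternalCategory C} {F : D ⟶ E} (hF : FullyFaithful F)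
    (H : G ⟶ E) (l : G.obj ⟶ D.obj) (hl : l ≫ F.obj = H.obj) :
    ∃ L : G ⟶ D, L.obj = l ∧ L ≫ F = H := by
  obtain ⟨n, h₁, h₂, h₃⟩ := hF.exists_lift (a := G.src ≫ l) (b := G.tgt ≫ l) (m := H.mor)
    (by simp [hl]) (by simp [hl])
  refine ⟨homOfElements l n h₁ h₂ (hF.hom_ext ?_ ?_ ?_) (fun {X} f g h => hF.hom_ext ?_ ?_ ?_),
    rfl, InternalCategory.hom_ext hl h₃⟩
  · simp [h₁]
  · simp [h₂]
  · simp [h₃, reassoc_of% hl]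
  · simp [h₁, mul_src, mul_src_assoc]
  · have : (f ≫ n) ≫ D.tgt = (g ≫ n) ≫ D.src := by simp [h₁, h₂, reassoc_of% h]
    simp [h₂, mul_tgt D this, reassoc_of% (mul_tgt G h)]
  · have : (f ≫ n) ≫ D.tgt = (g ≫ n) ≫ D.src := by simp [h₁, h₂, reassoc_of% h]
    rw [Category.assoc, h₃, mul_map H h, mul_map F this]
    simp [h₃]

theorem FullyFaithful.hom_ext_of_obj {D E G : InternalCategory C} {F : D ⟶ E}
    (hF : FullyFaithful F) {L L' : G ⟶ D} (h : L.obj = L'.obj) (h' : L ≫ F = L' ≫ F) : L = L' :=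
  InternalCategory.hom_ext h (hF.hom_ext (by simp [h]) (by simp [h]) (congrArg Hom.mor h'))

theorem fullyFaithful_id (D : InternalCategory C) : FullyFaithful (𝟙 D) :=
  fullyFaithful_of_elements (fun {X a b m} ha hb => ⟨m, by simpa using ha, by simpa using hb,
    by simp⟩) (fun _ _ h => by simpa using h)

/-- The data for `F` are included into those for `G`, lifted there and retracted; equivalences and
fibrations are treated in the same way below. -/
theorem FullyFaithful.of_retract {D E D' E' : InternalCategory C} {F : D ⟶ E} {G : D' ⟶ E'}
    (hG : FullyFaithful G) {i : D ⟶ D'} {r : D' ⟶ D} {i' : E ⟶ E'} {r' : E' ⟶ E}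
    (hi : i ≫ G = F ≫ i') (hr : r ≫ F = G ≫ r') (h : i ≫ r = 𝟙 D) (h' : i' ≫ r' = 𝟙 E) :
    FullyFaithful F := by
  have ho : i.obj ≫ r.obj = 𝟙 _ := congrArg Hom.obj h
  have hm : i.mor ≫ r.mor = 𝟙 _ := congrArg Hom.mor h
  have hm' : i'.mor ≫ r'.mor = 𝟙 _ := congrArg Hom.mor h'
  have hio : i.obj ≫ G.obj = F.obj ≫ i'.obj := congrArg Hom.obj hi
  have him : i.mor ≫ G.mor = F.mor ≫ i'.mor := congrArg Hom.mor hi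
  have hrm : r.mor ≫ F.mor = G.mor ≫ r'.mor := congrArg Hom.mor hr
  refine fullyFaithful_of_elements (fun {X a b m} ha hb => ?_) (fun {X m n} hs ht h => ?_)
  · obtain ⟨n, h₁, h₂, h₃⟩ := hG.exists_lift (a := a ≫ i.obj) (b := b ≫ i.obj) (m := m ≫ i'.mor)
      (by simp [reassoc_of% ha, hio]) (by simp [reassoc_of% hb, hio])
    refine ⟨n ≫ r.mor, ?_, ?_, ?_⟩
    · simp [reassoc_of% h₁, ho]
    · simp [reassoc_of% h₂, ho]
    · simp [hrm, reassoc_of% h₃, hm']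
  · have : m ≫ i.mor = n ≫ i.mor := hG.hom_ext (by simp [reassoc_of% hs])
      (by simp [reassoc_of% ht]) (by simp [him, reassoc_of% h])
    simpa [hm] using congr($this ≫ r.mor)

end

end InternalCategory

/-- The projectives of a Grothendieck topology detect epimorphisms and isomorphisms, and there are
enough of them. -/
class HasDetectingProjectives {C : Type u} [Category.{v} C] (J : GrothendieckTopology C) :
    Prop where
  epi {X Y : C} (f : X ⟶ Y) :
    (∀ P, IsTopologyProjective J P → ∀ b : P ⟶ Y, ∃ a, a ≫ f = b) → IsTopologyEpi J f
  enough : EnoughTopologyProjectives J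
  iso {X Y : C} (f : X ⟶ Y) :
    (∀ P, IsTopologyProjective J P → Function.Bijective (fun a : P ⟶ X => a ≫ f)) → IsIso f

/-! ### Equivalences and fibrations tested on projective objects -/

namespace InternalCategory

variable {C : Type u} [Category.{v} C] [HasFiniteLimits C] {J : GrothendieckTopology C}
  [HasDetectingProjectives J]

theorem isTopologyEpi_iff {C : Type u} [Category.{v} C] {J : GrothendieckTopology C}
    [HasDetectingProjectives J] {X Y : C} (f : X ⟶ Y) :
    IsTopologyEpi J f ↔ ∀ P, IsTopologyProjective J P → ∀ b : P ⟶ Y, ∃ a, a ≫ f = b :=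
  ⟨fun h _ hP b => hP f h b, HasDetectingProjectives.epi f⟩

theorem isoι_src (D : InternalCategory C) : D.isoι ≫ D.src = D.isoSrc := rfl

theorem isoι_tgt (D : InternalCategory C) : D.isoι ≫ D.tgt = D.isoTgt := rfl

/-- The conjugate of a generalized morphism. -/
noncomputable def conj (D : InternalCategory C) {X : C} (f m g : X ⟶ D.mor) : X ⟶ D.mor :=
  D.mul f (D.mul m g)

section

variable (D : InternalCategory C) {X : C} {f m g : X ⟶ D.mor}

theorem conj_src : D.conj f m g ≫ D.src = f ≫ D.src := mul_src _ _ _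

theorem conj_tgt (h : f ≫ D.tgt = m ≫ D.src) (h' : m ≫ D.tgt = g ≫ D.src) :
    D.conj f m g ≫ D.tgt = g ≫ D.tgt := by
  rw [conj, mul_tgt D (by rw [mul_src, h]), mul_tgt D h']

theorem comp_conj {Y : C} (k : Y ⟶ X) (h : f ≫ D.tgt = m ≫ D.src) (h' : m ≫ D.tgt = g ≫ D.src) :
    k ≫ D.conj f m g = D.conj (k ≫ f) (k ≫ m) (k ≫ g) := by
  rw [conj, comp_mul D _ (by rw [mul_src, h]), comp_mul D _ h', conj]

theorem conj_map {E : InternalCategory C} (F : D ⟶ E) (h : f ≫ D.tgt = m ≫ D.src)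
    (h' : m ≫ D.tgt = g ≫ D.src) :
    D.conj f m g ≫ F.mor = E.conj (f ≫ F.mor) (m ≫ F.mor) (g ≫ F.mor) := by
  rw [conj, mul_map F (by rw [mul_src, h]), mul_map F h', conj]

theorem conj_one_one {a b : X ⟶ D.obj} (h : a = m ≫ D.src) (h' : m ≫ D.tgt = b) :
    D.conj (a ≫ D.one) m (b ≫ D.one) = m := by
  rw [conj, mul_one D h', one_mul D h]

theorem conj_mul_one {b g' : X ⟶ D.mor} (hg : D.IsInverse g g') (h : b ≫ D.tgt = g ≫ D.src)
    {a : X ⟶ D.obj} (ha : a = g ≫ D.tgt) : D.conj (D.mul b g) (a ≫ D.one) g' = b := by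
  rw [conj, one_mul D (by rw [ha, hg.tgt_src]), mul_assoc D h hg.tgt_src, hg.mul_eq,
    ← Category.assoc, mul_one D h]

theorem conj_conj {f' g' : X ⟶ D.mor} (hf : D.IsInverse f f') (hg : D.IsInverse g g')
    (h : f ≫ D.tgt = m ≫ D.src) (h' : m ≫ D.tgt = g ≫ D.src) :
    D.conj f' (D.conj f m g) g' = m := by
  have e₁ : D.mul m g ≫ D.tgt = g' ≫ D.src := by rw [mul_tgt D h', hg.tgt_src]
  have e₂ : f ≫ D.tgt = D.mul m g ≫ D.src := by rw [mul_src, h]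
  rw [conj, conj, mul_assoc D e₂ e₁, hf.symm.mul_mul_cancel (by rw [mul_src, mul_src, h]),
    mul_assoc D h' hg.tgt_src, hg.mul_eq, ← Category.assoc, mul_one D h']

/-- The inner isomorphism meets its inverse and cancels; this is why conjugating a functor preserves
composition. -/
theorem conj_mul {g' n k : X ⟶ D.mor} (hg : D.IsInverse g g')
    (h₁ : f ≫ D.tgt = m ≫ D.src) (h₂ : m ≫ D.tgt = g ≫ D.src) (h₃ : g ≫ D.src = n ≫ D.src)
    (h₄ : n ≫ D.tgt = k ≫ D.src) :
    D.mul (D.conj f m g) (D.conj g' n k) = D.conj f (D.mul m n) k := by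
  have e₁ : f ≫ D.tgt = D.mul m g ≫ D.src := by rw [mul_src, h₁]
  have e₂ : g' ≫ D.tgt = D.mul n k ≫ D.src := by rw [mul_src, hg.src_tgt, h₃]
  have e₃ : D.mul m g ≫ D.tgt = D.mul g' (D.mul n k) ≫ D.src := by
    rw [mul_tgt D h₂, mul_src, hg.tgt_src]
  have e₄ : g ≫ D.tgt = D.mul g' (D.mul n k) ≫ D.src := by rw [mul_src, hg.tgt_src]
  rw [conj, conj, conj, mul_assoc D e₁ e₃, mul_assoc D h₂ e₄, hg.mul_mul_cancel e₂,
    mul_assoc D (by rw [h₂, h₃]) h₄]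

end

@[simp]
theorem isoMap_isoι {D E : InternalCategory C} (F : D ⟶ E) :
    isoMap F ≫ E.isoι = D.isoι ≫ F.mor := isoLift_isoι _ _

/-- Morphisms from `P` to `isoObj` are invertible `P`-elements, so lifting along `isoToPath` is the
isofibration property, with prescribed target, on `P`-elements. -/
theorem fib_iff {D E : InternalCategory C} (F : D ⟶ E) :
    fib J F ↔ ∀ P, IsTopologyProjective J P → ∀ (a : P ⟶ D.obj) (β β' : P ⟶ E.mor),
      E.IsInverse β β' → β ≫ E.tgt = a ≫ F.obj →
        ∃ α α', D.IsInverse α α' ∧ α ≫ D.tgt = a ∧ α ≫ F.mor = β := by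
  rw [fib, isTopologyEpi_iff]
  refine forall₂_congr fun P hP => ⟨fun h a β β' hβ e => ?_, fun h b => ?_⟩
  · obtain ⟨k, hk⟩ :=
      h (pullback.lift a (E.isoLift hβ) (by rw [isoTgt, ← Category.assoc, isoLift_isoι, e]))
    refine ⟨_, _, D.isInverse_iso.precomp k, ?_, ?_⟩
    · simpa [isoToPath, pullback.lift_fst, isoι_tgt] using congr($hk ≫ pullback.fst _ _)
    · simpa [isoToPath, pullback.lift_snd_assoc] using congr($hk ≫ pullback.snd _ _ ≫ E.isoι)
  · have hβ := E.isInverse_iso.precomp (b ≫ pullback.snd _ _)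
    obtain ⟨α, α', h₁, h₂, h₃⟩ := h (b ≫ pullback.fst _ _) _ _ hβ (by
      simpa [isoι_tgt] using congr(b ≫ $(pullback.condition (f := F.obj) (g := E.isoTgt))).symm)
    refine ⟨D.isoLift h₁, pullback.hom_ext ?_ ?_⟩
    · rw [Category.assoc, isoToPath, pullback.lift_fst, isoTgt, ← Category.assoc, isoLift_isoι, h₂]
    · have := E.mono_isoι
      rw [← cancel_mono E.isoι, Category.assoc (D.isoLift h₁), isoToPath, pullback.lift_snd,
          Category.assoc,
        isoMap_isoι, ← Category.assoc, isoLift_isoι, h₃]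

theorem essentiallySurjective_iff {D E : InternalCategory C} (F : D ⟶ E) :
    EssentiallySurjective J F ↔ ∀ P, IsTopologyProjective J P → ∀ b : P ⟶ E.obj,
      ∃ (a : P ⟶ D.obj) (β β' : P ⟶ E.mor), E.IsInverse β β' ∧ β ≫ E.src = b ∧
        β ≫ E.tgt = a ≫ F.obj := by
  rw [EssentiallySurjective, isTopologyEpi_iff]
  refine forall₃_congr fun P hP b => ⟨?_, ?_⟩
  · rintro ⟨k, rfl⟩
    refine ⟨k ≫ pullback.fst _ _, _, _, E.isInverse_iso.precomp (k ≫ pullback.snd _ _), ?_, ?_⟩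
    · simp [pathSrc, isoι_src]
    · simpa [isoι_tgt] using congr(k ≫ $(pullback.condition (f := F.obj) (g := E.isoTgt))).symm
  · rintro ⟨a, β, β', hβ, rfl, e⟩
    refine ⟨pullback.lift a (E.isoLift hβ) (by rw [isoTgt, ← Category.assoc, isoLift_isoι, e]), ?_⟩
    rw [pathSrc, pullback.lift_snd_assoc, isoSrc, ← Category.assoc, isoLift_isoι]

/-! ### The 2-out-of-3 property -/

theorem we_comp {D E G : InternalCategory C} {F : D ⟶ E} {H : E ⟶ G} (hF : we J F)
    (hH : we J H) : we J (F ≫ H) := by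
  refine ⟨hF.1.comp hH.1, (essentiallySurjective_iff _).2 fun P hP b => ?_⟩
  obtain ⟨a, γ, γ', hγ, h₁, h₂⟩ := (essentiallySurjective_iff _).1 hH.2 P hP b
  obtain ⟨c, β, β', hβ, h₃, h₄⟩ := (essentiallySurjective_iff _).1 hF.2 P hP a
  have e : γ ≫ G.tgt = (β ≫ H.mor) ≫ G.src := by simp [h₂, reassoc_of% h₃]
  exact ⟨c, _, _, hγ.mul (hβ.map H) e, by rw [mul_src, h₁], by simp [mul_tgt G e, reassoc_of% h₄]⟩

/-- The isomorphism obtained in `G` has both ends in the image of `H`, so it is reflected to `E` by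
full faithfulness. -/
theorem we_of_postcomp {D E G : InternalCategory C} {F : D ⟶ E} {H : E ⟶ G} (hH : we J H)
    (hFH : we J (F ≫ H)) : we J F := by
  refine ⟨hFH.1.of_comp hH.1, (essentiallySurjective_iff _).2 fun P hP b => ?_⟩
  obtain ⟨a, γ, γ', hγ, h₁, h₂⟩ := (essentiallySurjective_iff _).1 hFH.2 P hP (b ≫ H.obj)
  obtain ⟨n, n', hn, h₃, h₄, -⟩ := hH.1.exists_inverse hγ h₁ (b := a ≫ F.obj) (by simpa using h₂)
  exact ⟨a, n, n', hn, h₃, h₄⟩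

/-- Full faithfulness may be checked on projectives. -/
theorem fullyFaithful_of_projectives {D E : InternalCategory C} {F : D ⟶ E}
    (h₁ : ∀ P, IsTopologyProjective J P → ∀ (a b : P ⟶ D.obj) (m : P ⟶ E.mor),
      m ≫ E.src = a ≫ F.obj → m ≫ E.tgt = b ≫ F.obj →
        ∃ n : P ⟶ D.mor, n ≫ D.src = a ∧ n ≫ D.tgt = b ∧ n ≫ F.mor = m)
    (h₂ : ∀ P, IsTopologyProjective J P → ∀ m n : P ⟶ D.mor, m ≫ D.src = n ≫ D.src →
      m ≫ D.tgt = n ≫ D.tgt → m ≫ F.mor = n ≫ F.mor → m = n) : FullyFaithful F := by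
  -- Full faithfulness means that this comparison with the pullback is invertible. The two
  -- hypotheses say that it is surjective and injective on `P`-elements.
  let k : D.mor ⟶ pullback (prod.lift E.src E.tgt) (prod.map F.obj F.obj) :=
    pullback.lift F.mor (prod.lift D.src D.tgt) (lift_pair_eq F F.src F.tgt)
  have hk₁ : k ≫ pullback.fst _ _ = F.mor := pullback.lift_fst _ _ _
  have hk₂ : k ≫ pullback.snd _ _ = prod.lift D.src D.tgt := pullback.lift_snd _ _ _
  have : IsIso k := by
    refine HasDetectingProjectives.iso (J := J) k fun P hP => ⟨fun m n h => ?_, fun p => ?_⟩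
    · have e₁ := congr($h ≫ pullback.fst _ _)
      have e₂ := congr($h ≫ pullback.snd _ _ ≫ prod.fst)
      have e₃ := congr($h ≫ pullback.snd _ _ ≫ prod.snd)
      simp only [Category.assoc, hk₁, reassoc_of% hk₂, prod.lift_fst, prod.lift_snd] at e₁ e₂ e₃
      exact h₂ P hP m n e₂ e₃ e₁
    · have e := congr(p ≫ $(pullback.condition (f := prod.lift E.src E.tgt)
        (g := prod.map F.obj F.obj)))
      obtain ⟨n, e₁, e₂, e₃⟩ := h₁ P hP (p ≫ pullback.snd _ _ ≫ prod.fst)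
        (p ≫ pullback.snd _ _ ≫ prod.snd) (p ≫ pullback.fst _ _)
        (by simpa [prod.lift_fst, prod.map_fst] using congr($e ≫ prod.fst))
        (by simpa [prod.lift_snd, prod.map_snd] using congr($e ≫ prod.snd))
      refine ⟨n, pullback.hom_ext ?_ (prod.hom_ext ?_ ?_)⟩
      · simp [hk₁, e₃]
      · simp [hk₂, prod.lift_fst, e₁]
      · simp [hk₂, prod.lift_snd, e₂]
  exact IsPullback.of_iso_pullback ⟨lift_pair_eq F F.src F.tgt⟩ (asIso k) hk₁ hk₂

/-- Objects of `E` are isomorphic to images of objects of `D`, but such isomorphisms are only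
available over projective test objects; hence the use of `fullyFaithful_of_projectives`. A morphism
of `G` is conjugated until its ends come from `D`, lifted through `F ≫ H`, and conjugated back. -/
theorem we_of_precomp {D E G : InternalCategory C} {F : D ⟶ E} {H : E ⟶ G} (hF : we J F)
    (hFH : we J (F ≫ H)) : we J H := by
  refine ⟨fullyFaithful_of_projectives (J := J) (fun P hP b b' m hb hb' => ?_)
    (fun P hP k k' hs ht h => ?_), (essentiallySurjective_iff _).2 fun P hP b => ?_⟩
  · obtain ⟨a, β, γ, hβ, rfl, h₂⟩ := (essentiallySurjective_iff _).1 hF.2 P hP b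
    obtain ⟨a', β', γ', hβ', rfl, h₂'⟩ := (essentiallySurjective_iff _).1 hF.2 P hP b'
    have c₁ : (γ ≫ H.mor) ≫ G.tgt = m ≫ G.src := by simp [reassoc_of% hβ.src_tgt, hb]
    have c₂ : m ≫ G.tgt = (β' ≫ H.mor) ≫ G.src := by simp [hb']
    obtain ⟨n, e₁, e₂, e₃⟩ := hFH.1.exists_lift (a := a) (b := a')
      (m := G.conj (γ ≫ H.mor) m (β' ≫ H.mor))
      (by simp [conj_src, ← reassoc_of% hβ.tgt_src, reassoc_of% h₂])
      (by simp [conj_tgt G c₁ c₂, reassoc_of% h₂'])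
    have c₃ : β ≫ E.tgt = (n ≫ F.mor) ≫ E.src := by simp [h₂, reassoc_of% e₁]
    have c₄ : (n ≫ F.mor) ≫ E.tgt = γ' ≫ E.src := by
      simp [← hβ'.tgt_src, h₂', reassoc_of% e₂]
    refine ⟨E.conj β (n ≫ F.mor) γ', conj_src _, ?_, ?_⟩
    · rw [conj_tgt E c₃ c₄, hβ'.src_tgt]
    · rw [conj_map E H c₃ c₄, Category.assoc, ← comp_mor, e₃,
        conj_conj G (hβ.symm.map H) (hβ'.map H) c₁ c₂]
  · obtain ⟨a, β, γ, hβ, h₁, h₂⟩ := (essentiallySurjective_iff _).1 hF.2 P hP (k ≫ E.src)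
    obtain ⟨a', β', γ', hβ', h₁', h₂'⟩ := (essentiallySurjective_iff _).1 hF.2 P hP (k ≫ E.tgt)
    -- Any `l` parallel to `k` is the conjugate, by the same two isomorphisms, of the image of some
    -- `n` in `D`. Comparing `k` with `k'` thus reduces to comparing two such `n`, where `F ≫ H` is
    -- faithful.
    have key : ∀ l : P ⟶ E.mor, l ≫ E.src = k ≫ E.src → l ≫ E.tgt = k ≫ E.tgt →
        ∃ n : P ⟶ D.mor, n ≫ D.src = a ∧ n ≫ D.tgt = a' ∧ n ≫ F.mor = E.conj γ l β' ∧
          n ≫ F.mor ≫ H.mor = G.conj (γ ≫ H.mor) (l ≫ H.mor) (β' ≫ H.mor) ∧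
          l = E.conj β (n ≫ F.mor) γ' := by
      intro l hl hl'
      have c₁ : γ ≫ E.tgt = l ≫ E.src := by rw [hβ.src_tgt, h₁, hl]
      have c₂ : l ≫ E.tgt = β' ≫ E.src := by rw [h₁', hl']
      obtain ⟨n, e₁, e₂, e₃⟩ := hF.1.exists_lift (a := a) (b := a') (m := E.conj γ l β')
        (by rw [conj_src, ← hβ.tgt_src, h₂]) (by rw [conj_tgt E c₁ c₂, h₂'])
      exact ⟨n, e₁, e₂, e₃, by rw [← Category.assoc, e₃, conj_map E H c₁ c₂],
        by rw [e₃, conj_conj E hβ.symm hβ' c₁ c₂]⟩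
    obtain ⟨n, e₁, e₂, e₃, e₄, e₅⟩ := key k rfl rfl
    obtain ⟨n', e₁', e₂', e₃', e₄', e₅'⟩ := key k' hs.symm ht.symm
    have : n = n' := hFH.1.hom_ext (by rw [e₁, e₁']) (by rw [e₂, e₂'])
      (by rw [comp_mor, e₄, e₄', h])
    rw [e₅, e₅', this]
  · obtain ⟨a, γ, γ', hγ, h₁, h₂⟩ := (essentiallySurjective_iff _).1 hFH.2 P hP b
    exact ⟨a ≫ F.obj, γ, γ', hγ, h₁, by simpa using h₂⟩

variable (J) in
theorem we_hasTwoOutOfThreeProperty :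
    (we J : MorphismProperty (InternalCategory C)).HasTwoOutOfThreeProperty where
  comp_mem _ _ := we_comp
  of_postcomp _ _ := we_of_postcomp
  of_precomp _ _ := we_of_precomp

end InternalCategory

namespace InternalCategory

variable {C : Type u} [Category.{v} C] [HasFiniteLimits C] {J : GrothendieckTopology C}
  [HasDetectingProjectives J]

/-! ### Retracts -/

section Retracts

variable {D E D' E' : InternalCategory C} {F : D ⟶ E} {G : D' ⟶ E'} {i : D ⟶ D'} {r : D' ⟶ D}
  {i' : E ⟶ E'} {r' : E' ⟶ E} (hi : i ≫ G = F ≫ i') (hr : r ≫ F = G ≫ r') (h : i ≫ r = 𝟙 D)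
  (h' : i' ≫ r' = 𝟙 E)

include hi hr h h'

theorem we_of_retract (hG : we J G) : we J F := by
  refine ⟨hG.1.of_retract hi hr h h', (essentiallySurjective_iff F).2 fun P hP b => ?_⟩
  have ho' : i'.obj ≫ r'.obj = 𝟙 _ := congrArg Hom.obj h'
  have hro : r.obj ≫ F.obj = G.obj ≫ r'.obj := congrArg Hom.obj hr
  obtain ⟨a, β, β', hβ, h₁, h₂⟩ := (essentiallySurjective_iff G).1 hG.2 P hP (b ≫ i'.obj)
  refine ⟨a ≫ r.obj, _, _, hβ.map r', ?_, ?_⟩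
  · simp [reassoc_of% h₁, ho']
  · simp [reassoc_of% h₂, hro]

theorem fib_of_retract (hG : fib J G) : fib J F := by
  refine (fib_iff F).2 fun P hP a β β' hβ e => ?_
  have ho : i.obj ≫ r.obj = 𝟙 _ := congrArg Hom.obj h
  have hm' : i'.mor ≫ r'.mor = 𝟙 _ := congrArg Hom.mor h'
  have hio : i.obj ≫ G.obj = F.obj ≫ i'.obj := congrArg Hom.obj hi
  have hrm : r.mor ≫ F.mor = G.mor ≫ r'.mor := congrArg Hom.mor hr
  obtain ⟨α, α', hα, h₁, h₂⟩ := (fib_iff G).1 hG P hP (a ≫ i.obj) _ _ (hβ.map i')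
    (by simp [reassoc_of% e, hio])
  refine ⟨_, _, hα.map r, ?_, ?_⟩
  · simp [reassoc_of% h₁, ho]
  · simp [hrm, reassoc_of% h₂, hm']

end Retracts

instance : (we J : MorphismProperty (InternalCategory C)).IsStableUnderRetracts where
  of_retract h hG := we_of_retract (i := h.i.left) (r := h.r.left) (i' := h.i.right)
    (r' := h.r.right) h.i_w h.r_w h.retract_left h.retract_right hG

instance : (fib J : MorphismProperty (InternalCategory C)).IsStableUnderRetracts where
  of_retract h hG := fib_of_retract (i := h.i.left) (r := h.r.left) (i' := h.i.right)
    (r' := h.r.right) h.i_w h.r_w h.retract_left h.retract_right hG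

/-! ### Trivial fibrations and cofibrations -/

/-- An isomorphism `b ≅ F a` lifts along a fibration, and the source of the lift is sent exactly to
`b`: essential surjectivity becomes surjectivity. Conversely, once its source is lifted, an
isomorphism with given lift of its target is reflected by full faithfulness. -/
theorem we_inf_fib_iff {D E : InternalCategory C} (F : D ⟶ E) :
    (we J ⊓ fib J) F ↔ FullyFaithful F ∧ IsTopologyEpi J F.obj := by
  refine ⟨fun ⟨⟨h₁, h₂⟩, h₃⟩ => ⟨h₁, (isTopologyEpi_iff _).2 fun P hP b => ?_⟩, fun ⟨h₁, h₂⟩ =>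
    ⟨⟨h₁, (essentiallySurjective_iff F).2 fun P hP b => ?_⟩,
      (fib_iff F).2 fun P hP a β β' hβ e => ?_⟩⟩
  · obtain ⟨a, β, β', hβ, e₁, e₂⟩ := (essentiallySurjective_iff F).1 h₂ P hP b
    obtain ⟨α, α', hα, e₃, e₄⟩ := (fib_iff F).1 h₃ P hP a β β' hβ e₂
    exact ⟨α ≫ D.src, by rw [Category.assoc, ← map_src, ← Category.assoc, e₄, e₁]⟩
  · obtain ⟨a, rfl⟩ := hP _ h₂ b
    exact ⟨a, _, _, isInverse_one E (a ≫ F.obj), by simp, by simp⟩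
  · obtain ⟨a', ha'⟩ := hP _ h₂ (β ≫ E.src)
    obtain ⟨n, n', hn, -, e₂, e₃, -⟩ := h₁.exists_inverse hβ ha'.symm e
    exact ⟨n, n', hn, e₂, e₃⟩

/-- The presentation of the codiscrete internal category on an object. -/
noncomputable def codiscretePresentation (R : C) : Presentation C where
  obj := R
  mor := R ⨯ R
  src := prod.fst
  tgt := prod.snd
  one := diag R
  comp f g _ := prod.lift (f ≫ prod.fst) (g ≫ prod.snd)
  comp_nat k f g h h' := by simp [prod.comp_lift]
  one_src := by simp [prod.lift_fst]
  one_tgt := by simp [prod.lift_snd]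
  comp_src f g h := prod.lift_fst _ _
  comp_tgt f g h := prod.lift_snd _ _
  one_comp f h := by ext <;> simp [prod.lift_fst, prod.lift_snd]
  comp_one f h := by ext <;> simp [prod.lift_fst, prod.lift_snd]
  assoc f g h hfg hgh h₁ h₂ := by simp [prod.lift_fst, prod.lift_snd]

/-- The codiscrete internal category on an object. -/
noncomputable def codiscrete (R : C) : InternalCategory C := (codiscretePresentation R).toCat

theorem codiscrete_hom_ext {R X : C} {m n : X ⟶ (codiscrete R).mor}
    (h : m ≫ (codiscrete R).src = n ≫ (codiscrete R).src)
    (h' : m ≫ (codiscrete R).tgt = n ≫ (codiscrete R).tgt) : m = n :=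
  prod.hom_ext h h'

/-- The generalized morphism of a codiscrete internal category with given source and target. -/
noncomputable def codiscreteLift {R X : C} (a b : X ⟶ (codiscrete R).obj) :
    X ⟶ (codiscrete R).mor := prod.lift (X := R) (Y := R) a b

@[simp]
theorem codiscreteLift_src {R X : C} (a b : X ⟶ (codiscrete R).obj) :
    codiscreteLift a b ≫ (codiscrete R).src = a := prod.lift_fst (X := R) (Y := R) a b

@[simp]
theorem codiscreteLift_tgt {R X : C} (a b : X ⟶ (codiscrete R).obj) :
    codiscreteLift a b ≫ (codiscrete R).tgt = b := prod.lift_snd (X := R) (Y := R) a b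

/-- The internal functor to a codiscrete internal category given by a morphism on objects. -/
noncomputable def toCodiscrete {D : InternalCategory C} {R : C} (l : D.obj ⟶ (codiscrete R).obj) :
    D ⟶ codiscrete R :=
  homOfElements l (codiscreteLift (D.src ≫ l) (D.tgt ≫ l)) (by simp) (by simp)
    (codiscrete_hom_ext (by simp) (by simp))
    (fun {X} f g h => by
      have e : (f ≫ codiscreteLift (D.src ≫ l) (D.tgt ≫ l)) ≫ (codiscrete R).tgt =
        (g ≫ codiscreteLift (D.src ≫ l) (D.tgt ≫ l)) ≫ (codiscrete R).src := by
        simp [reassoc_of% h]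
      refine codiscrete_hom_ext ?_ ?_
      · simp [mul_src, mul_src_assoc]
      · simp [mul_tgt _ e, reassoc_of% (mul_tgt D h)])

theorem toCodiscrete_ext {D : InternalCategory C} {R : C} {F G : D ⟶ codiscrete R}
    (h : F.obj = G.obj) : F = G :=
  hom_ext h (codiscrete_hom_ext (by simp [h]) (by simp [h]))

/-- The internal functor between codiscrete internal categories induced by a morphism. -/
noncomputable def codiscreteMap {Q R : C} (p : Q ⟶ R) : codiscrete Q ⟶ codiscrete R :=
  toCodiscrete p

theorem fullyFaithful_codiscreteMap {Q R : C} (p : Q ⟶ R) : FullyFaithful (codiscreteMap p) :=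
  fullyFaithful_of_elements
    (fun {X a b m} ha hb => ⟨codiscreteLift a b, codiscreteLift_src a b, codiscreteLift_tgt a b,
      codiscrete_hom_ext
        (by rw [Category.assoc, map_src, ← Category.assoc, codiscreteLift_src, ha])
        (by rw [Category.assoc, map_tgt, ← Category.assoc, codiscreteLift_tgt, hb])⟩)
    (fun hs ht _ => codiscrete_hom_ext hs ht)

/-- A functor into a codiscrete category is the same as its object part, and `codiscreteMap p` is a
trivial fibration when `p` is epi; this gives the forward direction. Conversely, a lift on objects
against a fully faithful functor extends uniquely to morphisms. -/
theorem cof_iff {D E : InternalCategory C} (F : D ⟶ E) :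
    cof J F ↔ ∀ ⦃Q R : C⦄ (p : Q ⟶ R), IsTopologyEpi J p → HasLiftingProperty F.obj p := by
  constructor
  · refine fun h Q R p hp => ⟨fun {f g} sq => ?_⟩
    have := h (codiscreteMap p) ((we_inf_fib_iff _).2 ⟨fullyFaithful_codiscreteMap p, hp⟩)
    have sq' : CommSq (toCodiscrete f) F (codiscreteMap p) (toCodiscrete g) :=
      ⟨toCodiscrete_ext sq.w⟩
    exact ⟨⟨⟨sq'.lift.obj, congrArg Hom.obj sq'.fac_left, congrArg Hom.obj sq'.fac_right⟩⟩⟩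
  · intro h X Y p hp
    obtain ⟨h₁, h₂⟩ := (we_inf_fib_iff p).1 hp
    refine ⟨fun {f g} sq => ?_⟩
    have := h p.obj h₂
    have sq' : CommSq f.obj F.obj p.obj g.obj := ⟨congrArg Hom.obj sq.w⟩
    obtain ⟨L, hL, hL'⟩ := h₁.exists_hom g sq'.lift sq'.fac_right
    exact ⟨⟨⟨L, h₁.hom_ext_of_obj (by rw [comp_obj, hL, sq'.fac_left])
      (by rw [Category.assoc, hL', sq.w]), hL'⟩⟩⟩

/-! ### Pulling back the morphisms of an internal category -/

section Restrict

variable (A : InternalCategory C) {Z : C} (f : Z ⟶ A.obj)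

/-- The object of morphisms of `A` between objects in the image of `f`. -/
noncomputable abbrev restrictMor : C := pullback (prod.lift A.src A.tgt) (prod.map f f)

/-- The source. -/
noncomputable def restrictSrc : A.restrictMor f ⟶ Z := pullback.snd _ _ ≫ prod.fst

/-- The target. -/
noncomputable def restrictTgt : A.restrictMor f ⟶ Z := pullback.snd _ _ ≫ prod.snd

/-- The underlying morphism of `A`. -/
noncomputable def restrictι : A.restrictMor f ⟶ A.mor := pullback.fst _ _

theorem restrictι_src : A.restrictι f ≫ A.src = A.restrictSrc f ≫ f := by
  simpa [restrictSrc, restrictι, prod.lift_fst, prod.map_fst] using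
    congr($(pullback.condition (f := prod.lift A.src A.tgt) (g := prod.map f f)) ≫ prod.fst)

theorem restrictι_tgt : A.restrictι f ≫ A.tgt = A.restrictTgt f ≫ f := by
  simpa [restrictTgt, restrictι, prod.lift_snd, prod.map_snd] using
    congr($(pullback.condition (f := prod.lift A.src A.tgt) (g := prod.map f f)) ≫ prod.snd)

variable {A f} {X : C}

theorem restrict_hom_ext {m n : X ⟶ A.restrictMor f}
    (h₁ : m ≫ A.restrictSrc f = n ≫ A.restrictSrc f)
    (h₂ : m ≫ A.restrictTgt f = n ≫ A.restrictTgt f)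
    (h₃ : m ≫ A.restrictι f = n ≫ A.restrictι f) : m = n :=
  pullback.hom_ext h₃ (prod.hom_ext (by simpa [restrictSrc] using h₁)
    (by simpa [restrictTgt] using h₂))

/-- The morphism to the object of morphisms of the restriction. -/
noncomputable def restrictLift (a b : X ⟶ Z) (m : X ⟶ A.mor) (ha : m ≫ A.src = a ≫ f)
    (hb : m ≫ A.tgt = b ≫ f) : X ⟶ A.restrictMor f :=
  pullback.lift m (prod.lift a b) (by rw [prod.comp_lift, prod.lift_map, ha, hb])

section

variable (a b : X ⟶ Z) (m : X ⟶ A.mor) (ha : m ≫ A.src = a ≫ f) (hb : m ≫ A.tgt = b ≫ f)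

@[simp]
theorem restrictLift_src : restrictLift a b m ha hb ≫ A.restrictSrc f = a := by
  rw [restrictLift, restrictSrc, pullback.lift_snd_assoc, prod.lift_fst]

@[simp]
theorem restrictLift_tgt : restrictLift a b m ha hb ≫ A.restrictTgt f = b := by
  rw [restrictLift, restrictTgt, pullback.lift_snd_assoc, prod.lift_snd]

@[simp]
theorem restrictLift_ι : restrictLift a b m ha hb ≫ A.restrictι f = m := by
  rw [restrictLift, restrictι, pullback.lift_fst]

end

theorem restrict_composable {m n : X ⟶ A.restrictMor f}
    (h : m ≫ A.restrictTgt f = n ≫ A.restrictSrc f) :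
    (m ≫ A.restrictι f) ≫ A.tgt = (n ≫ A.restrictι f) ≫ A.src := by
  simp [restrictι_src, restrictι_tgt, reassoc_of% h]

/-- The composition of the restriction. -/
noncomputable def restrictComp (m n : X ⟶ A.restrictMor f)
    (h : m ≫ A.restrictTgt f = n ≫ A.restrictSrc f) : X ⟶ A.restrictMor f :=
  restrictLift (m ≫ A.restrictSrc f) (n ≫ A.restrictTgt f)
    (A.mul (m ≫ A.restrictι f) (n ≫ A.restrictι f))
    (by rw [mul_src, Category.assoc, restrictι_src, Category.assoc])
    (by rw [mul_tgt A (restrict_composable h), Category.assoc, restrictι_tgt, Category.assoc])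

variable (A f)

/-- The identities of the restriction. -/
noncomputable def restrictOne : Z ⟶ A.restrictMor f :=
  restrictLift (𝟙 Z) (𝟙 Z) (f ≫ A.one) (by simp) (by simp)

theorem restrictOne_ι : A.restrictOne f ≫ A.restrictι f = f ≫ A.one := restrictLift_ι ..

/-- The presentation of the restriction of an internal category along a morphism to its object of
objects. -/
noncomputable def restrictPresentation : Presentation C where
  obj := Z
  mor := A.restrictMor f
  src := A.restrictSrc f
  tgt := A.restrictTgt f
  one := restrictOne A f
  comp := restrictComp
  comp_nat k m n h h' := restrict_hom_ext (by simp [restrictComp]) (by simp [restrictComp])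
    (by simp [restrictComp, comp_mul A k (restrict_composable h)])
  one_src := by simp [restrictOne]
  one_tgt := by simp [restrictOne]
  comp_src m n h := by simp [restrictComp]
  comp_tgt m n h := by simp [restrictComp]
  one_comp m h :=
      restrict_hom_ext (by simp [restrictComp, restrictOne]) (by simp [restrictComp, restrictOne])
      (by
    simpa [restrictComp, restrictOne] using A.one_mul (a := m ≫ A.restrictSrc f ≫ f)
        (f := m ≫ A.restrictι f)
      (by simp [restrictι_src]))
  comp_one m h :=
      restrict_hom_ext (by simp [restrictComp, restrictOne]) (by simp [restrictComp, restrictOne])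
      (by
    simpa [restrictComp, restrictOne] using A.mul_one (a := m ≫ A.restrictTgt f ≫ f)
        (f := m ≫ A.restrictι f)
      (by simp [restrictι_tgt]))
  assoc m n k h h' h₁ h₂ := restrict_hom_ext (by simp [restrictComp]) (by simp [restrictComp]) (by
    simpa [restrictComp] using mul_assoc A (restrict_composable h) (restrict_composable h'))

variable {A f} in
theorem restrictComp_ι (m n : X ⟶ A.restrictMor f)
    (h : m ≫ A.restrictTgt f = n ≫ A.restrictSrc f) :
    restrictComp m n h ≫ A.restrictι f = A.mul (m ≫ A.restrictι f) (n ≫ A.restrictι f) :=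
  restrictLift_ι ..

/-- Every morphism to the object of objects extends to a fully faithful internal functor. -/
theorem exists_fullyFaithful_obj : ∃ (R : InternalCategory C) (e : Z ≅ R.obj) (r : R ⟶ A),
    FullyFaithful r ∧ e.hom ≫ r.obj = f := by
  let r : (A.restrictPresentation f).toCat ⟶ A :=
    homOfElements f (A.restrictι f) (restrictι_src A f) (restrictι_tgt A f)
      (restrictOne_ι A f)
      (fun {X} m n h => by
        rw [Presentation.mul_toCat (A.restrictPresentation f) h]
        exact restrictComp_ι m n h)
  refine ⟨_, Iso.refl _, r, fullyFaithful_of_elements (fun {X a b m} ha hb => ?_)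
    (fun {X m n} => ?_), ?_⟩
  · exact ⟨restrictLift a b m ha hb, restrictLift_src .., restrictLift_tgt .., restrictLift_ι ..⟩
  · exact restrict_hom_ext
  · exact Category.id_comp f

end Restrict

end InternalCategory

namespace InternalCategory

/-! ### Conjugating an internal functor by a family of isomorphisms -/

section Twist

variable {C : Type u} [Category.{v} C] [HasFiniteLimits C]
  {D E : InternalCategory C} (G : D ⟶ E) {θ θ' : D.obj ⟶ E.mor} (h : E.IsInverse θ θ')
  (hθ : θ ≫ E.tgt = G.obj)

include hθ in
theorem twist_left : (D.src ≫ θ) ≫ E.tgt = G.mor ≫ E.src := by simp [hθ]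

include h hθ in
theorem twist_right : G.mor ≫ E.tgt = (D.tgt ≫ θ') ≫ E.src := by simp [← h.tgt_src, hθ]

/-- The conjugate of an internal functor by a family of isomorphisms. -/
noncomputable def twist : D ⟶ E :=
  homOfElements (θ ≫ E.src) (E.conj (D.src ≫ θ) G.mor (D.tgt ≫ θ'))
    (by rw [conj_src, Category.assoc])
    (by rw [conj_tgt E (twist_left G hθ) (twist_right G h hθ), Category.assoc, h.src_tgt])
    (by
      rw [comp_conj E _ (twist_left G hθ) (twist_right G h hθ), conj, map_one, one_src_assoc,
        one_tgt_assoc, one_mul E (by rw [← h.tgt_src, hθ]), h.mul_eq, Category.assoc])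
    (fun {X} f g e => by
      have h₁ := twist_left G hθ
      have h₂ := twist_right G h hθ
      have a₁ : (f ≫ D.src ≫ θ) ≫ E.tgt = (f ≫ G.mor) ≫ E.src := by simp [hθ]
      have a₂ : (f ≫ G.mor) ≫ E.tgt = (f ≫ D.tgt ≫ θ') ≫ E.src := by simp [← h.tgt_src, hθ]
      have a₃ : (f ≫ D.tgt ≫ θ') ≫ E.src = (g ≫ G.mor) ≫ E.src := by
        simp [← h.tgt_src, hθ, reassoc_of% e]
      have a₄ : (g ≫ G.mor) ≫ E.tgt = (g ≫ D.tgt ≫ θ') ≫ E.src := by simp [← h.tgt_src, hθ]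
      -- By `e`, the isomorphism at the source of `g` is the one at the target of `f`, so `conj_mul`
      -- cancels the middle factors.
      rw [comp_conj E _ h₁ h₂, comp_conj E _ h₁ h₂, comp_conj E _ h₁ h₂, ← reassoc_of% e,
        conj_mul E (((h.symm).precomp D.tgt).precomp f) a₁ a₂ a₃ a₄, mul_src_assoc, mul_map G e,
        reassoc_of% (mul_tgt D e)])

end Twist

/-- `Z` is a coproduct of `X` and `Y`. -/
structure IsCoproduct {C : Type u} [Category.{v} C] {X Y Z : C} (i : X ⟶ Z) (k : Y ⟶ Z) :
    Prop where
  exists_desc {W : C} (f : X ⟶ W) (g : Y ⟶ W) : ∃ h : Z ⟶ W, i ≫ h = f ∧ k ≫ h = g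
  hom_ext {W : C} {f g : Z ⟶ W} : i ≫ f = i ≫ g → k ≫ f = k ≫ g → f = g

theorem isInverse_of_isCoproduct {C : Type u} [Category.{v} C] [HasPullbacks C]
    {D : InternalCategory C} {X Y Z : C} {i : X ⟶ Z} {k : Y ⟶ Z}
    (hc : IsCoproduct i k) {f g : Z ⟶ D.mor} (h₁ : D.IsInverse (i ≫ f) (i ≫ g))
    (h₂ : D.IsInverse (k ≫ f) (k ≫ g)) : D.IsInverse f g := by
  have e₁ : f ≫ D.tgt = g ≫ D.src := hc.hom_ext
    (by simpa using h₁.tgt_src) (by simpa using h₂.tgt_src)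
  have e₂ : g ≫ D.tgt = f ≫ D.src := hc.hom_ext
    (by simpa using h₁.src_tgt) (by simpa using h₂.src_tgt)
  rw [isInverse_iff]
  refine ⟨e₁, e₂, hc.hom_ext ?_ ?_, hc.hom_ext ?_ ?_⟩
  · simpa [comp_mul D _ e₁] using h₁.mul_eq
  · simpa [comp_mul D _ e₁] using h₂.mul_eq
  · simpa [comp_mul D _ e₂] using h₁.symm.mul_eq
  · simpa [comp_mul D _ e₂] using h₂.symm.mul_eq

/-! ### Lifting against fibrations, and cofibrant objects -/

variable {C : Type u} [Category.{v} C] [HasFiniteLimits C] {J : GrothendieckTopology C}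
  [HasDetectingProjectives J]

/-- The functor `r` is fully faithful and split epi on objects, hence a trivial fibration, and
2-out-of-3 applies. -/
theorem we_of_comp_eq_id {A R : InternalCategory C} {i : A ⟶ R} {r : R ⟶ A}
    (hr : FullyFaithful r) (hi : i ≫ r = 𝟙 A) : we J i := by
  have ho : i.obj ≫ r.obj = 𝟙 _ := congrArg Hom.obj hi
  have hid : we J (𝟙 A) := ((we_inf_fib_iff (𝟙 A)).2 ⟨fullyFaithful_id A,
    (isTopologyEpi_iff _).2 fun P hP b => ⟨b, by simp⟩⟩).1
  have hr' : we J r := ((we_inf_fib_iff r).2 ⟨hr,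
    (isTopologyEpi_iff _).2 fun P hP b => ⟨b ≫ i.obj, by simp [ho]⟩⟩).1
  exact we_of_postcomp hr' (hi ▸ hid)

/-- A section of a fully faithful internal functor, obtained by adding a projective to the objects,
has the left lifting property with respect to the fibrations. -/
theorem llp_fib_of_section {A R : InternalCategory C} {i : A ⟶ R} {r : R ⟶ A}
    (hr : FullyFaithful r) (hi : i ≫ r = 𝟙 A) {P : C} (hP : IsTopologyProjective J P)
    {k : P ⟶ R.obj} (hc : IsCoproduct i.obj k) : (fib J).llp i := by
  intro X Y Q hQ
  refine ⟨fun {u v} sq => ?_⟩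
  have ho : i.obj ≫ r.obj = 𝟙 _ := congrArg Hom.obj hi
  have hm : i.mor ≫ r.mor = 𝟙 _ := congrArg Hom.mor hi
  have wo : u.obj ≫ Q.obj = i.obj ≫ v.obj := congrArg Hom.obj sq.w
  have wm : u.mor ≫ Q.mor = i.mor ≫ v.mor := congrArg Hom.mor sq.w
  have hor {Z : C} (f : A.obj ⟶ Z) : i.obj ≫ r.obj ≫ f = f := by rw [reassoc_of% ho]
  -- `e` is the isomorphism in `R` from each object `x` to `i (r x)` lying over the identity of `r
  -- x`; by `hie` it is the identity on `A`.
  obtain ⟨e, e', he, he₁, he₂, he₃, he₄⟩ := hr.exists_inverse (a := 𝟙 _) (b := r.obj ≫ i.obj)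
    (A.isInverse_one r.obj) (by simp) (by simp [ho])
  have hie : i.obj ≫ e = i.obj ≫ R.one := hr.hom_ext (by simp [he₁])
    (by simp [he₂, hor]) (by simp [he₃])
  -- On `A` the diagonal is already given by `u`. Only on the new summand must the image of `e`
  -- under `v` be lifted along `Q`, which is possible since `P` is projective.
  obtain ⟨α, α', hα, hα₁, hα₂⟩ := (fib_iff Q).1 hQ P hP (k ≫ r.obj ≫ u.obj) _ _
    ((he.map v).precomp k) (by simp [reassoc_of% he₂, wo])
  obtain ⟨θ, hθ₁, hθ₂⟩ := hc.exists_desc (u.obj ≫ X.one) α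
  obtain ⟨θ', hθ₁', hθ₂'⟩ := hc.exists_desc (u.obj ≫ X.one) α'
  have hθ : X.IsInverse θ θ' := isInverse_of_isCoproduct hc
    (by rw [hθ₁, hθ₁']; exact X.isInverse_one _) (by rw [hθ₂, hθ₂']; exact hα)
  have ht : θ ≫ X.tgt = (r ≫ u).obj := hc.hom_ext
    (by simp [reassoc_of% hθ₁, hor]) (by simp [reassoc_of% hθ₂, hα₁])
  have hQ₁ : θ ≫ Q.mor = e ≫ v.mor := hc.hom_ext
    (by simp [reassoc_of% hθ₁, reassoc_of% hie, reassoc_of% wo])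
    (by simp [reassoc_of% hθ₂, hα₂])
  have hQ₂ : θ' ≫ Q.mor = e' ≫ v.mor := (hθ.map Q).unique (by rw [hQ₁]; exact he.map v)
  -- The filler restricts to `u` because `θ` is the identity on `A`. It lies over `v` because `θ`
  -- lies over the image of `e`, and conjugating `r ≫ i` by `e` gives the identity of `R` (`key`).
  refine ⟨⟨⟨twist (r ≫ u) hθ ht, hom_ext ?_ ?_, hom_ext ?_ ?_⟩⟩⟩
  · change i.obj ≫ θ ≫ X.src = u.obj
    simp [reassoc_of% hθ₁]
  · change i.mor ≫ X.conj (R.src ≫ θ) (r ≫ u).mor (R.tgt ≫ θ') = u.mor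
    rw [comp_conj X _ (twist_left _ ht) (twist_right _ hθ ht)]
    simp only [comp_mor, map_src_assoc, map_tgt_assoc, hθ₁, hθ₁', reassoc_of% hm]
    rw [← Category.assoc, ← Category.assoc, conj_one_one X (by simp) (by simp)]
  · change (θ ≫ X.src) ≫ Q.obj = v.obj
    rw [Category.assoc, ← map_src, reassoc_of% hQ₁, map_src, reassoc_of% he₁]
  · change X.conj (R.src ≫ θ) (r ≫ u).mor (R.tgt ≫ θ') ≫ Q.mor = v.mor
    have a₁ : (R.src ≫ e) ≫ R.tgt = (r.mor ≫ i.mor) ≫ R.src := by simp [he₂]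
    have a₂ : (r.mor ≫ i.mor) ≫ R.tgt = (R.tgt ≫ e') ≫ R.src := by simp [← he.tgt_src, he₂]
    have key : R.conj (R.src ≫ e) (r.mor ≫ i.mor) (R.tgt ≫ e') = 𝟙 _ := hr.hom_ext
      (by simp [conj_src, he₁]) (by simp [conj_tgt R a₁ a₂, he.src_tgt, he₁]) (by
        rw [conj_map R r a₁ a₂, Category.assoc, Category.assoc, Category.assoc, he₃, he₄, hm,
          ← Category.assoc, ← Category.assoc, conj_one_one A (by simp) (by simp)]
        simp)
    rw [conj_map X Q (twist_left _ ht) (twist_right _ hθ ht), Category.assoc, Category.assoc, hQ₁,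
      hQ₂, comp_mor, Category.assoc, wm, ← Category.assoc, ← Category.assoc, ← Category.assoc,
      ← conj_map R v a₁ a₂, key, Category.id_comp]

/-- An internal category is cofibrant if and only if its object of objects is projective. -/
theorem cof_initial_iff [HasInitial (InternalCategory C)] (X : InternalCategory C) :
    cof J (initial.to X) ↔ IsTopologyProjective J X.obj := by
  constructor
  · intro h Q R p hp l
    have := h (codiscreteMap p) ((we_inf_fib_iff _).2 ⟨fullyFaithful_codiscreteMap p, hp⟩)
    have sq : CommSq (initial.to _) (initial.to X) (codiscreteMap p) (toCodiscrete l) :=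
      ⟨initial.hom_ext _ _⟩
    exact ⟨sq.lift.obj, congrArg Hom.obj sq.fac_right⟩
  · intro h A B p hp
    obtain ⟨h₁, h₂⟩ := (we_inf_fib_iff p).1 hp
    refine ⟨fun {f g} sq => ?_⟩
    obtain ⟨l, hl⟩ := h _ h₂ g.obj
    obtain ⟨L, -, hL⟩ := h₁.exists_hom g l hl
    exact ⟨⟨⟨L, initial.hom_ext _ _, hL⟩⟩⟩

/-! ### Factorizations and the model structure -/

variable [HasBinaryCoproducts C]

attribute [local simp] coprod.inl_desc coprod.inr_desc coprod.inl_desc_assoc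
  coprod.inr_desc_assoc

/-- A projective cover `P` of the objects of `B` is added to the objects of `A`, and the morphisms
are pulled back from `B`. On objects `i` is a coproduct inclusion with projective complement, and
`p` is epi because of `P`. -/
theorem exists_factorization_cof {A B : InternalCategory C} (F : A ⟶ B) :
    ∃ (E : InternalCategory C) (i : A ⟶ E) (p : E ⟶ B),
      cof J i ∧ (we J ⊓ fib J) p ∧ i ≫ p = F := by
  obtain ⟨P, q, hP, hq⟩ := HasDetectingProjectives.enough (J := J) B.obj
  obtain ⟨E, e, p, hp, hep⟩ := B.exists_fullyFaithful_obj (coprod.desc F.obj q)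
  obtain ⟨i, hi, hip⟩ := hp.exists_hom F (coprod.inl ≫ e.hom) (by simp [hep])
  refine ⟨E, i, p, (cof_iff i).2 fun Q R t ht => ⟨fun {f g} sq => ?_⟩, (we_inf_fib_iff p).2 ⟨hp,
    (isTopologyEpi_iff _).2 fun T hT b => ?_⟩, hip⟩
  · obtain ⟨l, hl⟩ := hP t ht (coprod.inr ≫ e.hom ≫ g)
    have w := sq.w
    rw [hi, Category.assoc] at w
    refine ⟨⟨⟨e.inv ≫ coprod.desc f l, by simp [hi], ?_⟩⟩⟩
    rw [Category.assoc, Iso.inv_comp_eq]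
    ext
    · simp [w]
    · simp [hl]
  · obtain ⟨a, ha⟩ := hT q hq b
    exact ⟨a ≫ coprod.inr ≫ e.hom, by simp [hep, ha]⟩

/-- Here `P` covers the mapping path object, a point of which is an isomorphism `b ≅ F a`. Each such
point is added to `A` as a copy of `a`, which does not change `A` up to equivalence, and is sent to
`b`. -/
theorem exists_factorization_fib {A B : InternalCategory C} (F : A ⟶ B) :
    ∃ (E : InternalCategory C) (i : A ⟶ E) (p : E ⟶ B),
      (fib J).llp i ∧ we J i ∧ fib J p ∧ i ≫ p = F := by
  obtain ⟨P, q, hP, hq⟩ := HasDetectingProjectives.enough (J := J) (pathObj F)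
  obtain ⟨R, e, r, hr, her⟩ := A.exists_fullyFaithful_obj (coprod.desc (𝟙 A.obj)
    (q ≫ pullback.fst _ _))
  obtain ⟨i, hi, hir⟩ := hr.exists_hom (𝟙 A) (coprod.inl ≫ e.hom) (by simp [her])
  have ho : i.obj ≫ r.obj = 𝟙 _ := congrArg Hom.obj hir
  have hm : i.mor ≫ r.mor = 𝟙 _ := congrArg Hom.mor hir
  have hk : (coprod.inr ≫ e.hom) ≫ r.obj = q ≫ pullback.fst _ _ := by simp [her]
  generalize hk' : coprod.inr ≫ e.hom = k at hk
  have hc : IsCoproduct i.obj k := by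
    refine ⟨fun f g => ⟨e.inv ≫ coprod.desc f g, by simp [hi], by simp [← hk']⟩, fun h h' => ?_⟩
    rw [← cancel_epi e.hom]
    exact coprod.hom_ext (by simpa [hi] using h) (by simpa [← hk'] using h')
  have hι := B.isInverse_iso.precomp (q ≫ pullback.snd _ _)
  -- `θ` is the identity on `A` and the tautological isomorphism `b ≅ F a` on `P`, so conjugating `r
  -- ≫ F` by it moves the image of the new object from `F a` to `b`.
  obtain ⟨θ, hθ₁, hθ₂⟩ := hc.exists_desc (F.obj ≫ B.one)
    ((q ≫ pullback.snd _ _) ≫ B.isoι)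
  obtain ⟨θ', hθ₁', hθ₂'⟩ := hc.exists_desc (F.obj ≫ B.one)
    ((q ≫ pullback.snd _ _) ≫ B.isoInv)
  have hθ : B.IsInverse θ θ' := isInverse_of_isCoproduct hc
    (by rw [hθ₁, hθ₁']; exact B.isInverse_one _) (by rw [hθ₂, hθ₂']; exact hι)
  have ht : θ ≫ B.tgt = (r ≫ F).obj := hc.hom_ext
    (by simp [reassoc_of% hθ₁, reassoc_of% ho])
    (by
      have := congr(q ≫ $(pullback.condition (f := F.obj) (g := B.isoTgt)))
      simpa [reassoc_of% hθ₂, reassoc_of% hk, isoι_tgt] using this.symm)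
  refine ⟨R, i, twist (r ≫ F) hθ ht, llp_fib_of_section hr hir hP hc, we_of_comp_eq_id hr hir,
    (fib_iff _).2 fun T hT a β β' hβ hβa => ?_, hom_ext ?_ ?_⟩
  · change β ≫ B.tgt = a ≫ θ ≫ B.src at hβa
    have hβθ : β ≫ B.tgt = (a ≫ θ) ≫ B.src := by rw [hβa, Category.assoc]
    -- Composing `β` with `θ` gives an isomorphism with target `F (r a)`, that is, a point of the
    -- path object. Its lift `t` to `P` names the source of the required lift of `β`.
    have hmul := hβ.mul (hθ.precomp a) hβθ
    obtain ⟨t, ht'⟩ := hT q hq (pullback.lift (a ≫ r.obj) (B.isoLift hmul) (by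
      rw [← isoι_tgt, ← Category.assoc (B.isoLift hmul), isoLift_isoι, mul_tgt B hβθ,
        Category.assoc, Category.assoc, ht, comp_obj]))
    have ht₁ : t ≫ q ≫ pullback.fst _ _ = a ≫ r.obj := by
      rw [← Category.assoc, ht', pullback.lift_fst]
    have ht₂ : t ≫ q ≫ pullback.snd _ _ ≫ B.isoι = B.mul β (a ≫ θ) := by
      rw [← Category.assoc, ht', pullback.lift_snd_assoc, isoLift_isoι]
    -- `γ` is chosen over an identity of `A`, so its image is `β` times `θ` times the inverse of
    -- `θ`.
    obtain ⟨γ, γ', hγ, h₁, h₂, h₃, -⟩ := hr.exists_inverse (a := t ≫ k) (b := a)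
      (A.isInverse_one (a ≫ r.obj)) (by simp [hk, ht₁]) (by simp)
    refine ⟨γ, γ', hγ, h₂, ?_⟩
    change γ ≫ B.conj (R.src ≫ θ) (r ≫ F).mor (R.tgt ≫ θ') = β
    rw [comp_conj B _ (twist_left _ ht) (twist_right _ hθ ht), reassoc_of% h₁, reassoc_of% h₂,
      hθ₂, comp_mor, reassoc_of% h₃, map_one, Category.assoc, ht₂, ← Category.assoc,
      ← Category.assoc]
    exact conj_mul_one B (hθ.precomp a) hβθ (by simp [ht])
  · change i.obj ≫ θ ≫ B.src = F.obj
    simp [reassoc_of% hθ₁]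
  · change i.mor ≫ B.conj (R.src ≫ θ) (r ≫ F).mor (R.tgt ≫ θ') = F.mor
    rw [comp_conj B _ (twist_left _ ht) (twist_right _ hθ ht)]
    simp only [comp_mor, map_src_assoc, map_tgt_assoc, hθ₁, hθ₁', reassoc_of% hm]
    rw [← Category.assoc, ← Category.assoc, conj_one_one B (by simp) (by simp)]

/-- Retract argument: in a factorization of `F` into `i` followed by a fibration `p`, 2-out-of-3
makes `p` a trivial fibration. So `F` lifts against `p` and is a retract of `i`. -/
theorem llp_fib_of_cof_of_we {A B : InternalCategory C} {F : A ⟶ B} (h₁ : cof J F)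
    (h₂ : we J F) : (fib J).llp F := by
  obtain ⟨E, i, p, hi, hi', hp, rfl⟩ := exists_factorization_fib (J := J) F
  have hp' : we J p := we_of_precomp hi' h₂
  have := h₁ p ⟨hp', hp⟩
  exact (fib J).llp.of_retract (RetractArrow.ofLeftLiftingProperty rfl) hi

variable (J) in
/-- The model structure on internal categories determined by a Grothendieck topology. -/
@[reducible]
noncomputable def modelCategory [HasFiniteColimits (InternalCategory C)] :
    ModelCategory (InternalCategory C) where
  categoryWithFibrations := ⟨fib J⟩
  categoryWithCofibrations := ⟨cof J⟩
  categoryWithWeakEquivalences := ⟨we J⟩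
  cm2 := we_hasTwoOutOfThreeProperty J
  cm3a := inferInstanceAs (we J).IsStableUnderRetracts
  cm3b := inferInstanceAs (fib J).IsStableUnderRetracts
  cm3c := inferInstanceAs (we J ⊓ fib J).llp.IsStableUnderRetracts
  cm4a i p hi hi' hp := llp_fib_of_cof_of_we (J := J) hi.1 hi'.1 p hp.1
  cm4b i p hi hp hp' := hi.1 p ⟨hp'.1, hp.1⟩
  cm5a := ⟨fun F => by
    obtain ⟨E, i, p, hi, hi', hp, e⟩ := exists_factorization_fib (J := J) F
    exact ⟨⟨E, i, p, e, ⟨fun _ _ p hp => hi p hp.2, hi'⟩, hp⟩⟩⟩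
  cm5b := ⟨fun F => by
    obtain ⟨E, i, p, hi, hp, e⟩ := exists_factorization_cof (J := J) F
    exact ⟨⟨E, i, p, e, hi, ⟨hp.2, hp.1⟩⟩⟩⟩

end InternalCategory

/-! ### The categorically surjective topology -/

theorem mem_tauPrime_iff {X : Cat.{u, u}} (S : Sieve X) :
    S ∈ tauPrime X ↔ ∃ (Y : Cat.{u, u}) (F : Y ⟶ X), CategoricallySurjective F ∧ S.arrows F := by
  refine (Pretopology.mem_toGrothendieck _ _ _).trans ⟨?_, ?_⟩
  · rintro ⟨_, ⟨Y, F, hF, rfl⟩, h⟩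
    exact ⟨Y, F, hF, h _ _ (Presieve.singleton_self F)⟩
  · rintro ⟨Y, F, hF, h⟩
    refine ⟨_, ⟨Y, F, hF, rfl⟩, ?_⟩
    rintro _ _ ⟨⟩
    exact h

/-- A map of presheaves becomes epi after sheafification exactly when it is locally surjective, and
for representables it suffices to lift the identity of `B` locally. -/
theorem isTopologyEpi_tauPrime_iff {A B : Cat.{u, u}} (p : A ⟶ B) :
    IsTopologyEpi tauPrime p ↔ ∃ (Y : Cat.{u, u}) (F : Y ⟶ B) (l : Y ⟶ A),
      CategoricallySurjective F ∧ l ≫ p = F := by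
  have key : IsTopologyEpi tauPrime p ↔
      Presheaf.IsLocallySurjective tauPrime (uliftYoneda.{u + 1, u, u + 1}.map p) :=
    (Sheaf.isLocallySurjective_iff_epi _).symm.trans
      (Presheaf.isLocallySurjective_presheafToSheaf_map_iff tauPrime
        (uliftYoneda.{u + 1, u, u + 1}.map p))
  rw [key]
  constructor
  · rintro ⟨h⟩
    obtain ⟨Y, F, hF, t, ht⟩ := (mem_tauPrime_iff _).1 (h (U := B) (ULift.up (𝟙 B)))
    exact ⟨Y, F, t.down, hF, congr(($ht).down).trans (Category.comp_id F)⟩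
  · rintro ⟨Y, F, l, hF, h⟩
    refine ⟨fun {U} s => ?_⟩
    -- The cover `F` is pulled back along an arbitrary section `s`; on the new cover `s` factors
    -- through `F`, hence through `p`.
    obtain ⟨Z, G, hG, e⟩ := (mem_tauPrime_iff (Sieve.pullback s.down (Sieve.generate
      (Presieve.singleton F)))).1 (GrothendieckTopology.pullback_stable _ _
        ((mem_tauPrime_iff _).2 ⟨Y, F, hF, Sieve.le_generate _ _ _ (Presieve.singleton_self F)⟩))
    obtain ⟨_, k, _, ⟨⟩, hk⟩ := e
    refine (mem_tauPrime_iff _).2 ⟨Z, G, hG, ULift.up (k ≫ l), ?_⟩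
    refine congrArg ULift.up ((Category.assoc k l p).trans ?_)
    rw [h]
    exact hk

theorem CategoricallySurjective.isTopologyEpi {A B : Cat.{u, u}} {F : A ⟶ B}
    (hF : CategoricallySurjective F) : IsTopologyEpi tauPrime F :=
  (isTopologyEpi_tauPrime_iff F).2 ⟨A, F, 𝟙 A, hF, Category.id_comp F⟩

/-- Preimages are chosen for vertices by surjectivity and for edges by fullness; a free category
imposes no relation on them. -/
theorem CategoricallySurjective.exists_lift {A B : Cat.{u, u}} {F : A ⟶ B}
    (hF : CategoricallySurjective F) {V : Type u} [Quiver.{u} V] (H : Paths V ⥤ B) :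
    ∃ K : Paths V ⥤ A, K ⋙ F.toFunctor = H := by
  choose o ho using fun x : V => hF.1 (H.obj x)
  have := hF.2
  choose m hm using fun (x y : V) (e : x ⟶ y) => F.toFunctor.map_surjective
    (eqToHom (ho x) ≫ H.map ((Paths.of V).map e) ≫ eqToHom (ho y).symm)
  let φ : V ⥤q A := ⟨o, fun e => m _ _ e⟩
  refine ⟨Quiv.lift φ, Paths.ext_functor (funext ho) fun a b e => Eq.trans ?_ (hm a b e)⟩
  exact congrArg F.toFunctor.map (composePath_toPath (φ.map e))

theorem isTopologyProjective_free (G : Quiv.{u, u}) :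
    IsTopologyProjective tauPrime (Cat.free.obj G) := fun Q R g hg H => by
  obtain ⟨Y, F, l, hF, rfl⟩ := (isTopologyEpi_tauPrime_iff g).1 hg
  obtain ⟨K, hK⟩ := hF.exists_lift (V := G) H.toFunctor
  exact ⟨K.toCatHom ≫ l, Cat.Hom.ext hK⟩

theorem categoricallySurjective_counit (A : Cat.{u, u}) :
    CategoricallySurjective (Quiv.adj.counit.app A) :=
  ⟨fun x => ⟨x, rfl⟩, ⟨fun {_ _} m => ⟨Quiver.Hom.toPath m, composePath_toPath m⟩⟩⟩

theorem enoughTopologyProjectives_tauPrime : EnoughTopologyProjectives tauPrime.{u} := fun A =>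
  ⟨_, Quiv.adj.counit.app A, isTopologyProjective_free _,
    (categoricallySurjective_counit A).isTopologyEpi⟩

/-! ### Isomorphisms of categories and the walking arrow -/

theorem Cat.isIso_of_bijective {A B : Cat.{u, u}} (F : A ⟶ B)
    (h : Function.Bijective F.toFunctor.obj) (h₁ : F.toFunctor.Full) (h₂ : F.toFunctor.Faithful) :
    IsIso F := by
  choose g hg using h.2
  let G : B ⥤ A :=
    { obj := g
      map {x y} m := F.toFunctor.preimage (eqToHom (hg x) ≫ m ≫ eqToHom (hg y).symm)
      map_id x := F.toFunctor.map_injective (by simp)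
      map_comp m n := F.toFunctor.map_injective (by simp) }
  refine ⟨G.toCatHom, Cat.Hom.ext ?_, Cat.Hom.ext ?_⟩
  · refine CategoryTheory.Functor.ext (fun x => h.1 (hg _)) fun x y m => ?_
    apply F.toFunctor.map_injective
    change F.toFunctor.map (F.toFunctor.preimage _) = F.toFunctor.map (_ ≫ m ≫ _)
    rw [Functor.map_preimage, Functor.map_comp, Functor.map_comp, eqToHom_map, eqToHom_map]
  · refine CategoryTheory.Functor.ext hg fun x y m => ?_
    change F.toFunctor.map (F.toFunctor.preimage _) = _ ≫ m ≫ _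
    rw [Functor.map_preimage]

/-- The vertices of the walking arrow. -/
inductive WalkingVertex : Type u
  | src
  | tgt

/-- The only arrow of the walking arrow. -/
inductive WalkingEdge : WalkingVertex.{u} → WalkingVertex.{u} → Type u
  | mk : WalkingEdge .src .tgt

instance : Quiver.{u, u} WalkingVertex.{u} := ⟨WalkingEdge⟩

/-- The functor picking a morphism of a category. -/
def pickArrow {A : Cat.{u, u}} {x y : A} (m : x ⟶ y) :
    Cat.free.obj (Quiv.of WalkingVertex.{u}) ⟶ A :=
  (Quiv.lift (V := WalkingVertex.{u})
    { obj := fun | .src => x | .tgt => y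
      map := fun | .mk => m }).toCatHom

/-- The arrow of the free category on the walking arrow. -/
def walkingArrow : @Quiver.Hom (Paths WalkingVertex.{u}) _ WalkingVertex.src WalkingVertex.tgt :=
  Quiver.Hom.toPath WalkingEdge.mk

theorem pickArrow_map {A : Cat.{u, u}} {x y : A} (m : x ⟶ y) :
    (pickArrow m).toFunctor.map walkingArrow = m :=
  composePath_toPath m

theorem walkingArrow_functor_ext {A : Type u} [Category.{u} A] {a b : Paths WalkingVertex.{u} ⥤ A}
    (h₁ : a.obj WalkingVertex.src = b.obj WalkingVertex.src)
    (h₂ : a.obj WalkingVertex.tgt = b.obj WalkingVertex.tgt)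
    (h : a.map walkingArrow = eqToHom h₁ ≫ b.map walkingArrow ≫ eqToHom h₂.symm) : a = b := by
  refine Paths.ext_functor ?_ ?_
  · funext x
    cases x
    · exact h₁
    · exact h₂
  · rintro _ _ ⟨⟩
    exact h

theorem eqToHom_comp_comp_eqToHom {A : Type u} [Category.{v} A] {a b : A} (m : a ⟶ b)
    (h : a = a) (h' : b = b) : eqToHom h ≫ m ≫ eqToHom h' = m := by simp

theorem comp_pickArrow {A B : Cat.{u, u}} {x y : A} (m : x ⟶ y) (F : A ⟶ B) :
    pickArrow m ≫ F = pickArrow (F.toFunctor.map m) :=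
  Cat.Hom.ext (walkingArrow_functor_ext rfl rfl (((congrArg F.toFunctor.map (pickArrow_map m)).trans
    (pickArrow_map (F.toFunctor.map m)).symm).trans (eqToHom_comp_comp_eqToHom _ _ _).symm))

theorem exists_eq_pickArrow {A : Cat.{u, u}} (a : Cat.free.obj (Quiv.of WalkingVertex.{u}) ⟶ A) :
    ∃ (x y : A) (m : x ⟶ y), a = pickArrow m :=
  ⟨_, _, a.toFunctor.map walkingArrow, Cat.Hom.ext (walkingArrow_functor_ext rfl rfl
    ((pickArrow_map _).symm.trans (eqToHom_comp_comp_eqToHom _ _ _).symm))⟩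

theorem pickArrow_injective {A : Cat.{u, u}} {x y : A} {m n : x ⟶ y}
    (h : pickArrow m = pickArrow n) : m = n := by
  have := congr_arg_heq (fun K : Cat.free.obj (Quiv.of WalkingVertex.{u}) ⟶ A =>
    K.toFunctor.map walkingArrow) (a₁ := pickArrow m) (a₂ := pickArrow n) h
  exact (pickArrow_map m).symm.trans ((eq_of_heq this).trans (pickArrow_map n))

theorem pickArrow_injective_src {A : Cat.{u, u}} {x y x' y' : A} {m : x ⟶ y} {n : x' ⟶ y'}
    (h : pickArrow m = pickArrow n) : x = x' :=
  congr(($h).toFunctor.obj WalkingVertex.src)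

theorem pickArrow_injective_tgt {A : Cat.{u, u}} {x y x' y' : A} {m : x ⟶ y} {n : x' ⟶ y'}
    (h : pickArrow m = pickArrow n) : y = y' :=
  congr(($h).toFunctor.obj WalkingVertex.tgt)

/-- If `f` lifts the counit of its codomain, a categorically surjective functor factors through it.
A bijection on functors out of the walking arrow is a bijection on morphisms, and identities take
care of the objects. -/
instance : HasDetectingProjectives tauPrime.{u} where
  epi {X Y} f h := by
    obtain ⟨a, ha⟩ := h _ (isTopologyProjective_free _) (Quiv.adj.counit.app Y)
    exact (isTopologyEpi_tauPrime_iff f).2 ⟨_, _, a, categoricallySurjective_counit Y, ha⟩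
  enough := enoughTopologyProjectives_tauPrime
  iso {X Y} f h := by
    have hW := h _ (isTopologyProjective_free (Quiv.of WalkingVertex.{u}))
    have hid (x : X) : pickArrow (𝟙 x) ≫ f = pickArrow (𝟙 (f.toFunctor.obj x)) :=
      (comp_pickArrow _ f).trans (congrArg pickArrow (f.toFunctor.map_id x))
    have inj : Function.Injective f.toFunctor.obj := fun x y e =>
      pickArrow_injective_src (hW.1 ((hid x).trans (.trans (by rw [e]) (hid y).symm)))
    refine Cat.isIso_of_bijective f ⟨inj, fun y => ?_⟩ ⟨fun {x y} m => ?_⟩ ⟨fun {x y m n} e => ?_⟩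
    · obtain ⟨a, ha⟩ := hW.2 (pickArrow (𝟙 y))
      exact ⟨a.toFunctor.obj WalkingVertex.src, congr(($ha).toFunctor.obj WalkingVertex.src)⟩
    · obtain ⟨a, ha⟩ := hW.2 (pickArrow m)
      obtain ⟨x', y', n, rfl⟩ := exists_eq_pickArrow a
      have ha' := (comp_pickArrow n f).symm.trans ha
      obtain rfl := inj (pickArrow_injective_src ha')
      obtain rfl := inj (pickArrow_injective_tgt ha')
      exact ⟨n, pickArrow_injective ha'⟩
    · exact pickArrow_injective (hW.1 ((comp_pickArrow m f).trans
        ((congrArg pickArrow e).trans (comp_pickArrow n f).symm)))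

/-! ### Projective categories are free -/

/-- A length function on the morphisms of a category for which any two factorizations of a morphism
have a common refinement. -/
structure EquidivisibleLength (A : Type u) [Category.{v} A] where
  /-- the length of a morphism -/
  len : ∀ {x y : A}, (x ⟶ y) → ℕ
  len_id (x : A) : len (𝟙 x) = 0
  len_comp {x y z : A} (f : x ⟶ y) (g : y ⟶ z) : len (f ≫ g) = len f + len g
  eq_of_len {x y : A} (f : x ⟶ y) : len f = 0 → ∃ h : x = y, f = eqToHom h
  refine {x y y' z : A} (f : x ⟶ y) (g : y ⟶ z) (f' : x ⟶ y') (g' : y' ⟶ z) :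
    f ≫ g = f' ≫ g' → (∃ w, f ≫ w = f' ∧ g = w ≫ g') ∨ ∃ w, f' ≫ w = f ∧ g' = w ≫ g

namespace EquidivisibleLength

variable {A : Type u} [Category.{v} A] (L : EquidivisibleLength A)

/-- The irreducible morphisms. -/
def Irreducible {x y : A} (f : x ⟶ y) : Prop :=
  L.len f ≠ 0 ∧ ∀ {z : A} (g : x ⟶ z) (h : z ⟶ y), g ≫ h = f → L.len g = 0 ∨ L.len h = 0

/-- The objects of `A`, as the vertices of the directed graph of irreducible morphisms. -/
@[nolint unusedArguments]
def Vertex (_ : EquidivisibleLength A) : Type u := A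

/-- The directed graph of irreducible morphisms. -/
instance : Quiver.{v} L.Vertex := ⟨fun x y => {f : @Quiver.Hom A _ x y // L.Irreducible f}⟩

/-- The inclusion of the irreducible morphisms. -/
def incl : L.Vertex ⥤q A where
  obj x := x
  map e := e.1

/-- The functor from the free category on the irreducible morphisms. -/
abbrev eval : Paths L.Vertex ⥤ A := Quiv.lift L.incl

theorem eval_cons {x y z : L.Vertex} (p : Quiver.Path x y) (e : y ⟶ z) :
    L.eval.map (p.cons e : @Quiver.Hom (Paths L.Vertex) _ x z) =
        L.eval.map (p : @Quiver.Hom (Paths L.Vertex) _ x y) ≫ L.incl.map e := rfl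

/-- Induction on length: a reducible morphism is a composite of two factors of nonzero length, both
of which are therefore shorter. -/
theorem exists_path (n : ℕ) : ∀ {x y : A} (f : x ⟶ y), L.len f ≤ n →
    ∃ p : @Quiver.Hom (Paths L.Vertex) _ x y, L.eval.map p = f := by
  induction n with
  | zero =>
    intro x y f h
    obtain ⟨rfl, rfl⟩ := L.eq_of_len f (by omega)
    exact ⟨𝟙 _, rfl⟩
  | succ n ih =>
    intro x y f h
    by_cases h₀ : L.len f = 0
    · obtain ⟨rfl, rfl⟩ := L.eq_of_len f h₀
      exact ⟨𝟙 _, rfl⟩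
    by_cases hf : L.Irreducible f
    · exact ⟨(Paths.of L.Vertex).map ⟨f, hf⟩, composePath_toPath f⟩
    · simp only [Irreducible, not_and, not_forall, not_or] at hf
      obtain ⟨z, g, k, rfl, h₁, h₂⟩ := hf h₀
      rw [L.len_comp] at h
      obtain ⟨p, rfl⟩ := ih g (by omega)
      obtain ⟨q, rfl⟩ := ih k (by omega)
      exact ⟨p ≫ q, L.eval.map_comp p q⟩

/-- The refinement `w` divides an irreducible last factor whose other part has nonzero length; so
`w` has length zero and is an identity. -/
theorem eq_of_comp_irreducible {x y y' z : A} {f : x ⟶ y} {g : y ⟶ z} {f' : x ⟶ y'} {g' : y' ⟶ z}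
    (hg : L.Irreducible g) (hg' : L.Irreducible g') (h : f ≫ g = f' ≫ g') :
    ∃ e : y = y', f ≫ eqToHom e = f' ∧ g = eqToHom e ≫ g' := by
  rcases L.refine f g f' g' h with ⟨w, h₁, h₂⟩ | ⟨w, h₁, h₂⟩
  · obtain ⟨rfl, rfl⟩ := L.eq_of_len w ((hg.2 w g' h₂.symm).resolve_right hg'.1)
    exact ⟨rfl, h₁, h₂⟩
  · obtain ⟨rfl, rfl⟩ := L.eq_of_len w ((hg'.2 w g h₂.symm).resolve_right hg.1)
    exact ⟨rfl, by simpa using h₁.symm, by simpa using h₂.symm⟩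

theorem eval_injective {x y : L.Vertex} (p q : Quiver.Path x y)
    (h : L.eval.map (p : @Quiver.Hom (Paths L.Vertex) _ x y) =
        L.eval.map (q : @Quiver.Hom (Paths L.Vertex) _ x y)) : p = q := by
  have key : ∀ {z : L.Vertex} (r : Quiver.Path x z) (e : z ⟶ x),
      L.eval.map (r.cons e : @Quiver.Hom (Paths L.Vertex) _ x x) ≠ 𝟙 (L.incl.obj x) := by
    intro z r e h
    have := (L.len_comp (L.eval.map r) (L.incl.map e)).symm.trans
      ((congrArg L.len h).trans (L.len_id (L.incl.obj x)))
    exact e.2.1 (Nat.eq_zero_of_add_eq_zero_left this)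
  induction p with
  | nil =>
    cases q with
    | nil => rfl
    | cons r e => exact absurd h.symm (key r e)
  | cons r e ih =>
    cases q with
    | nil => exact absurd h (key r e)
    | cons r' e' =>
      rw [eval_cons, eval_cons] at h
      obtain ⟨w, h₁, h₂⟩ := L.eq_of_comp_irreducible e.2 e'.2 h
      -- `w` equates objects of `A`; it is read as an equality of vertices so that it can be
      -- substituted in the paths.
      obtain rfl := id (α := @Eq L.Vertex _ _) w
      rw [ih r' ((Category.comp_id (L.eval.map r)).symm.trans h₁),
        show e = e' from Subtype.ext (h₂.trans (Category.id_comp (L.incl.map e')))]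

end EquidivisibleLength

theorem EquidivisibleLength.isFreeOnGraph {A : Cat.{u, u}} (L : EquidivisibleLength A) :
    IsFreeOnGraph A := by
  let F : Cat.free.obj (Quiv.of L.Vertex) ⟶ A := L.eval.toCatHom
  have : IsIso F := Cat.isIso_of_bijective F ⟨fun _ _ h => h, fun x => ⟨x, rfl⟩⟩
    ⟨fun m => L.exists_path _ m le_rfl⟩ ⟨fun {_ _ p q} h => L.eval_injective p q h⟩
  exact ⟨_, ⟨(asIso F).symm⟩⟩

/-- Levi's lemma for paths: common last edges are stripped until one of the two tails is empty, and
what is left of the other is `w`. -/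
theorem Quiver.Path.comp_eq_comp {V : Type u} [Quiver.{v} V] {a b b' : V} (p : Quiver.Path a b)
    (p' : Quiver.Path a b') {c : V} (q : Quiver.Path b c) (q' : Quiver.Path b' c)
    (h : p.comp q = p'.comp q') :
    (∃ w, p.comp w = p' ∧ q = w.comp q') ∨ ∃ w, p'.comp w = p ∧ q' = w.comp q := by
  induction q with
  | nil => exact .inr ⟨q', h.symm, rfl⟩
  | cons r e ih =>
    cases q' with
    | nil => exact .inl ⟨r.cons e, h, rfl⟩
    | cons r' e' =>
      rw [Quiver.Path.comp_cons, Quiver.Path.comp_cons] at h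
      obtain ⟨rfl, k₁, k₂⟩ := Quiver.Path.cons.inj h
      obtain rfl := eq_of_heq k₂
      rcases ih r' (eq_of_heq k₁) with ⟨w, h₁, rfl⟩ | ⟨w, h₁, rfl⟩
      · exact .inl ⟨w, h₁, rfl⟩
      · exact .inr ⟨w, h₁, rfl⟩

section Retract

variable {A : Type u} [Category.{v} A] {B : Type u} [Category.{max u v} B] (i : A ⥤ B) (r : B ⥤ A)
  (h : i ⋙ r = 𝟭 A)

/-- The retraction on morphisms between objects in the image. -/
def retractMap {x y : A} (p : i.obj x ⟶ i.obj y) : x ⟶ y :=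
  (eqToIso h).inv.app x ≫ r.map p ≫ (eqToIso h).hom.app y

theorem retractMap_map {x y : A} (f : x ⟶ y) : retractMap i r h (i.map f) = f := by
  have : r.map (i.map f) ≫ (eqToIso h).hom.app y = (eqToIso h).hom.app x ≫ f :=
    (eqToIso h).hom.naturality f
  rw [retractMap, this]
  exact (eqToIso h).inv_hom_id_app_assoc x f

theorem retractMap_comp {x y z : A} (p : i.obj x ⟶ i.obj y) (q : i.obj y ⟶ i.obj z) :
    retractMap i r h (p ≫ q) = retractMap i r h p ≫ retractMap i r h q := by
  simp only [retractMap, Functor.map_comp, Category.assoc]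
  congr 2
  exact ((eqToIso h).hom_inv_id_app_assoc y _).symm

end Retract

/-- The length of morphisms of a retract of a free category. -/
def EquidivisibleLength.ofRetract {A : Type u} [Category.{v} A] {V : Type u} [Quiver.{v} V]
    (i : A ⥤ Paths V) (r : Paths V ⥤ A) (h : i ⋙ r = 𝟭 A) : EquidivisibleLength A where
  len f := Quiver.Path.length (V := V) (i.map f)
  len_id x := by rw [i.map_id]; rfl
  len_comp f g := by rw [i.map_comp]; exact Quiver.Path.length_comp _ _
  eq_of_len {x y} f hf := by
    have e : i.obj x = i.obj y := Quiver.Path.eq_of_length_zero (V := V) (i.map f) hf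
    obtain rfl : x = y :=
      (Functor.congr_obj h x).symm.trans ((congrArg r.obj e).trans (Functor.congr_obj h y))
    refine ⟨rfl, ?_⟩
    have h₁ : i.map f = i.map (𝟙 x) :=
      (Quiver.Path.eq_nil_of_length_zero (V := V) (i.map f) hf).trans (i.map_id x).symm
    rw [← retractMap_map i r h f, h₁, retractMap_map, eqToHom_refl]
  refine {x y y' z} f g f' g' e := by
    have e' : i.map f ≫ i.map g = i.map f' ≫ i.map g' := by rw [← i.map_comp, e, i.map_comp]
    rcases Quiver.Path.comp_eq_comp (V := V) (i.map f) (i.map f') (i.map g) (i.map g') e' with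
      ⟨w, h₁, h₂⟩ | ⟨w, h₁, h₂⟩
    -- `w` need not come from `A`, but its endpoints do, so it can be retracted, and `retractMap`
    -- preserves both equations.
    · refine .inl ⟨retractMap i r h w, ?_, ?_⟩
      · exact (congrArg (· ≫ _) (retractMap_map i r h f).symm).trans
          ((retractMap_comp i r h _ _).symm.trans
            ((congrArg (retractMap i r h) h₁).trans (retractMap_map i r h f')))
      · exact (retractMap_map i r h g).symm.trans ((congrArg (retractMap i r h) h₂).trans
          ((retractMap_comp i r h w (i.map g')).trans
            (congrArg (retractMap i r h w ≫ ·) (retractMap_map i r h g'))))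
    · refine .inr ⟨retractMap i r h w, ?_, ?_⟩
      · exact (congrArg (· ≫ _) (retractMap_map i r h f').symm).trans
          ((retractMap_comp i r h _ _).symm.trans
            ((congrArg (retractMap i r h) h₁).trans (retractMap_map i r h f)))
      · exact (retractMap_map i r h g').symm.trans ((congrArg (retractMap i r h) h₂).trans
          ((retractMap_comp i r h w (i.map g)).trans
            (congrArg (retractMap i r h w ≫ ·) (retractMap_map i r h g))))

theorem IsFreeOnGraph.isTopologyProjective {A : Cat.{u, u}} (h : IsFreeOnGraph A) :
    IsTopologyProjective tauPrime A := by
  obtain ⟨G, ⟨e⟩⟩ := h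
  intro Q R g hg H
  obtain ⟨K, hK⟩ := isTopologyProjective_free G g hg (e.inv ≫ H)
  exact ⟨e.hom ≫ K, by rw [Category.assoc, hK, e.hom_inv_id_assoc]⟩

/-- Lifting the identity along the counit makes a projective category a retract of a free one. -/
theorem isTopologyProjective_tauPrime_iff (A : Cat.{u, u}) :
    IsTopologyProjective tauPrime A ↔ IsFreeOnGraph A := by
  refine ⟨fun h => ?_, fun h => h.isTopologyProjective⟩
  obtain ⟨i, hi⟩ := h _ (categoricallySurjective_counit A).isTopologyEpi (𝟙 A)
  exact (EquidivisibleLength.ofRetract (V := A) i.toFunctor (pathComposition A)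
    congr(($hi).toFunctor)).isFreeOnGraph

/-! ### Subcategories cut out by a set of morphisms -/

namespace CategoryTheory.Cat

/-- The free category on the walking arrow. -/
abbrev Walking : Cat.{u, u} := Cat.free.obj (Quiv.of WalkingVertex.{u})

/-- A set of morphisms closed under sources, targets and composition. -/
structure IsClosedSet {B : Cat.{u, u}} (S : Set (Walking ⟶ B)) : Prop where
  id_src {x y : B} (m : x ⟶ y) : pickArrow m ∈ S → pickArrow (𝟙 x) ∈ S
  id_tgt {x y : B} (m : x ⟶ y) : pickArrow m ∈ S → pickArrow (𝟙 y) ∈ S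
  comp {x y z : B} (m : x ⟶ y) (n : y ⟶ z) :
    pickArrow m ∈ S → pickArrow n ∈ S → pickArrow (m ≫ n) ∈ S

theorem IsClosedSet.preimage {A B : Cat.{u, u}} {S : Set (Walking ⟶ B)} (hS : IsClosedSet S)
    (F : A ⟶ B) : IsClosedSet {a : Walking ⟶ A | a ≫ F ∈ S} where
  id_src {x y} m h := by
    simp only [Set.mem_ofPred_eq] at h ⊢
    rw [comp_pickArrow] at h ⊢
    exact (F.toFunctor.map_id x).symm ▸ hS.id_src _ h
  id_tgt {x y} m h := by
    simp only [Set.mem_ofPred_eq] at h ⊢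
    rw [comp_pickArrow] at h ⊢
    exact (F.toFunctor.map_id y).symm ▸ hS.id_tgt _ h
  comp {x y z} m n h h' := by
    simp only [Set.mem_ofPred_eq] at h h' ⊢
    rw [comp_pickArrow] at h h' ⊢
    exact (F.toFunctor.map_comp m n).symm ▸ hS.comp _ _ h h'

/-- The subcategory consisting of a closed set of morphisms. -/
structure ClosedSubcategory {B : Cat.{u, u}} {S : Set (Walking ⟶ B)} (hS : IsClosedSet S) :
    Type u where
  /-- the underlying object -/
  obj : B
  property : pickArrow (𝟙 obj) ∈ S

section

variable {B : Cat.{u, u}} {S : Set (Walking ⟶ B)} (hS : IsClosedSet S)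

instance : Category.{u} (ClosedSubcategory hS) where
  Hom x y := {m : x.obj ⟶ y.obj // pickArrow m ∈ S}
  id x := ⟨𝟙 _, x.property⟩
  comp f g := ⟨f.1 ≫ g.1, hS.comp _ _ f.2 g.2⟩
  id_comp _ := Subtype.ext (Category.id_comp _)
  comp_id _ := Subtype.ext (Category.comp_id _)
  assoc _ _ _ := Subtype.ext (Category.assoc _ _ _)

/-- The inclusion of the subcategory. -/
def ClosedSubcategory.ι : Cat.of (ClosedSubcategory hS) ⟶ B :=
  Cat.Hom.ofFunctor
    { obj := fun x => x.obj
      map := fun f => f.1 }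

/-- The lift of a functor to the subcategory. -/
def ClosedSubcategory.lift {X : Cat.{u, u}} (F : X ⟶ B) (hF : ∀ x : Walking ⟶ X, x ≫ F ∈ S) :
    X ⥤ ClosedSubcategory hS where
  obj x := ⟨F.toFunctor.obj x, (F.toFunctor.map_id x) ▸ comp_pickArrow (𝟙 x) F ▸ hF _⟩
  map m := ⟨F.toFunctor.map m, comp_pickArrow m F ▸ hF _⟩
  map_id x := Subtype.ext (F.toFunctor.map_id x)
  map_comp m n := Subtype.ext (F.toFunctor.map_comp m n)

theorem ClosedSubcategory.exists_lift_iff {X : Cat.{u, u}} (F : X ⟶ B) :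
    (∃ l : X ⟶ Cat.of (ClosedSubcategory hS), l ≫ ClosedSubcategory.ι hS = F) ↔
      ∀ x : Walking ⟶ X, x ≫ F ∈ S := by
  constructor
  · rintro ⟨l, rfl⟩ x
    obtain ⟨a, b, m, hm⟩ := exists_eq_pickArrow (x ≫ l)
    rw [← Category.assoc, hm, comp_pickArrow]
    exact m.2
  · intro h
    exact ⟨(ClosedSubcategory.lift hS F h).toCatHom, rfl⟩

end

theorem mono_of_faithful {A B : Cat.{u, u}} (F : A ⟶ B)
    (h : Function.Injective F.toFunctor.obj) (h' : F.toFunctor.Faithful) : Mono F where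
  right_cancellation {X} a b e := by
    have e' : a.toFunctor ⋙ F.toFunctor = b.toFunctor ⋙ F.toFunctor := congr(($e).toFunctor)
    refine Cat.Hom.ext (CategoryTheory.Functor.ext (fun x => h (Functor.congr_obj e' x))
      fun x y m => F.toFunctor.map_injective ?_)
    rw [Functor.map_comp, Functor.map_comp, eqToHom_map, eqToHom_map]
    exact Functor.congr_hom e' m

/-- Transport of structure: up to isomorphism, the categories whose objects and hom-sets embed in
`T` form a small set. -/
theorem exists_smallCategoryOfSet {A : Cat.{u, u}} {T : Type u} (f₁ : A ↪ T)
    (f₂ : ∀ x y : A, (x ⟶ y) ↪ T) :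
    ∃ s : SmallCategoryOfSet T, Nonempty (Cat.of s.obj ≅ A) := by
  let e := Equiv.ofInjective f₁ f₁.injective
  let h : CoreSmallCategoryOfSet T A :=
    { obj := Set.range f₁
      hom x y := Set.range (f₂ (e.symm x) (e.symm y))
      objEquiv := e.symm
      homEquiv {x y} := (Equiv.ofInjective _ ((f₂ (e.symm x) (e.symm y)).injective)).symm }
  let F : Cat.of h.smallCategoryOfSet.obj ⟶ A := h.functor.toCatHom
  have : IsIso F := Cat.isIso_of_bijective F h.objEquiv.bijective h.fullyFaithfulFunctor.full
    h.fullyFaithfulFunctor.faithful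
  exact ⟨_, ⟨asIso F⟩⟩

theorem exists_smallCategoryOfSet_of_isClosedSet {B : Cat.{u, u}} {S : Set (Walking ⟶ B)}
    (hS : IsClosedSet S) {T : Type u} (e : T → (Walking ⟶ B)) (he : S ⊆ Set.range e) :
    ∃ (s : SmallCategoryOfSet T) (ι : Cat.of s.obj ⟶ B), Mono ι ∧
      ∀ {X : Cat.{u, u}} (F : X ⟶ B), (∃ l, l ≫ ι = F) ↔ ∀ x : Walking ⟶ X, x ≫ F ∈ S := by
  choose c hc using fun a : S => he a.2
  have hc' : Function.Injective c := fun a b h => Subtype.ext (by rw [← hc a, ← hc b, h])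
  obtain ⟨s, ⟨φ⟩⟩ := exists_smallCategoryOfSet (A := Cat.of (ClosedSubcategory hS)) (T := T)
    ⟨fun x => c ⟨_, x.property⟩, fun x y h => by
      obtain ⟨x, hx⟩ := x
      obtain ⟨y, hy⟩ := y
      obtain rfl : x = y := pickArrow_injective_src congr(($(hc' h)).1)
      rfl⟩
    (fun x y => ⟨fun m => c ⟨_, m.2⟩, fun m n h =>
      Subtype.ext (pickArrow_injective congr(($(hc' h)).1))⟩)
  have : Mono (ClosedSubcategory.ι hS) := mono_of_faithful _
    (fun x y h => by
      obtain ⟨x, hx⟩ := x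
      obtain ⟨y, hy⟩ := y
      obtain rfl : x = y := h
      rfl)
    ⟨fun h => Subtype.ext h⟩
  refine ⟨s, φ.hom ≫ ClosedSubcategory.ι hS, mono_comp _ _, fun F => ?_⟩
  rw [← ClosedSubcategory.exists_lift_iff hS F]
  constructor
  · rintro ⟨l, rfl⟩
    exact ⟨l ≫ φ.hom, Category.assoc _ _ _⟩
  · rintro ⟨l, rfl⟩
    exact ⟨l ≫ φ.inv, by rw [Category.assoc, φ.inv_hom_id_assoc]⟩

end CategoryTheory.Cat

/-! ### Internal subcategories -/

namespace InternalCategory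

section Sub

variable {C : Type u} [Category.{v} C] [HasPullbacks C]

/-- The structure of an internal category on given objects of objects and of morphisms. -/
structure Str (O M : C) where
  /-- source -/
  src : M ⟶ O
  /-- target -/
  tgt : M ⟶ O
  /-- identities -/
  one : O ⟶ M
  /-- composition of composable pairs -/
  comp : pullback tgt src ⟶ M
  one_src : one ≫ src = 𝟙 O
  one_tgt : one ≫ tgt = 𝟙 O
  comp_src : comp ≫ src = pullback.fst tgt src ≫ src
  comp_tgt : comp ≫ tgt = pullback.snd tgt src ≫ tgt
  one_comp : ∀ {X : C} (f : X ⟶ M) (h : (f ≫ src ≫ one) ≫ tgt = f ≫ src),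
    pullback.lift (f ≫ src ≫ one) f h ≫ comp = f
  comp_one : ∀ {X : C} (f : X ⟶ M) (h : f ≫ tgt = (f ≫ tgt ≫ one) ≫ src),
    pullback.lift f (f ≫ tgt ≫ one) h ≫ comp = f
  assoc : ∀ {X : C} (f g h : X ⟶ M) (hfg : f ≫ tgt = g ≫ src) (hgh : g ≫ tgt = h ≫ src)
    (h₁ : (pullback.lift f g hfg ≫ comp) ≫ tgt = h ≫ src)
    (h₂ : f ≫ tgt = (pullback.lift g h hgh ≫ comp) ≫ src),
    pullback.lift (pullback.lift f g hfg ≫ comp) h h₁ ≫ comp =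
      pullback.lift f (pullback.lift g h hgh ≫ comp) h₂ ≫ comp

/-- The internal category with a given structure. -/
@[reducible]
def Str.toCat {O M : C} (s : Str O M) : InternalCategory C := { s with obj := O, mor := M }

/-- The structure of an internal category. -/
def toStr (D : InternalCategory C) : Str D.obj D.mor := { D with }

variable {D : InternalCategory C} {O M : C} {ι₀ : O ⟶ D.obj} {ι₁ : M ⟶ D.mor}

/-- A pair of subobjects closed under the operations of an internal category. -/
structure IsSub (D : InternalCategory C) {O M : C} (ι₀ : O ⟶ D.obj) (ι₁ : M ⟶ D.mor) : Prop where
  mono₀ : Mono ι₀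
  mono₁ : Mono ι₁
  src : ∃ l, l ≫ ι₀ = ι₁ ≫ D.src
  tgt : ∃ l, l ≫ ι₀ = ι₁ ≫ D.tgt
  one : ∃ l, l ≫ ι₁ = ι₀ ≫ D.one
  comp {X : C} (f g : X ⟶ M) : (f ≫ ι₁) ≫ D.tgt = (g ≫ ι₁) ≫ D.src →
    ∃ l, l ≫ ι₁ = D.mul (f ≫ ι₁) (g ≫ ι₁)

/-- The operations restrict by assumption, and the laws hold because they do after composing with
the monomorphisms. Producing a `Str` on the given `O` and `M` keeps the possible subcategories
indexed by a small type. -/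
theorem IsSub.exists_str (h : IsSub D ι₀ ι₁) :
    ∃ (s : Str O M) (F : s.toCat ⟶ D), F.obj = ι₀ ∧ F.mor = ι₁ := by
  have := h.mono₀
  have := h.mono₁
  obtain ⟨s, hs⟩ := h.src
  obtain ⟨t, ht⟩ := h.tgt
  obtain ⟨o, ho⟩ := h.one
  have hc : ∀ {X : C} (f g : X ⟶ M), f ≫ t = g ≫ s → (f ≫ ι₁) ≫ D.tgt = (g ≫ ι₁) ≫ D.src := by
    intro X f g e
    rw [Category.assoc, Category.assoc, ← hs, ← ht, reassoc_of% e]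
  choose c hc' using fun (X : C) (f g : X ⟶ M) (e : f ≫ t = g ≫ s) => h.comp f g (hc f g e)
  let P : Presentation C :=
    { obj := O
      mor := M
      src := s
      tgt := t
      one := o
      comp := fun {X} f g e => c X f g e
      comp_nat := fun k f g e e' => by
        rw [← cancel_mono ι₁, Category.assoc, hc' _ _ _ e, hc' _ _ _ e', comp_mul D _ (hc f g e),
          Category.assoc, Category.assoc]
      one_src := by
        rw [← cancel_mono ι₀, Category.assoc, hs, reassoc_of% ho, D.one_src, Category.comp_id,
          Category.id_comp]
      one_tgt := by
        rw [← cancel_mono ι₀, Category.assoc, ht, reassoc_of% ho, D.one_tgt, Category.comp_id,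
          Category.id_comp]
      comp_src := fun f g e => by
        rw [← cancel_mono ι₀, Category.assoc, hs, reassoc_of% (hc' _ f g e), mul_src,
            Category.assoc,
          Category.assoc, hs]
      comp_tgt := fun f g e => by
        rw [← cancel_mono ι₀, Category.assoc, ht, reassoc_of% (hc' _ f g e), mul_tgt D (hc f g e),
          Category.assoc, Category.assoc, ht]
      one_comp := fun f e => by
        rw [← cancel_mono ι₁, hc' _ _ _ e, Category.assoc, Category.assoc, ho, reassoc_of% hs]
        simpa using D.one_mul (f := f ≫ ι₁) rfl
      comp_one := fun f e => by
        rw [← cancel_mono ι₁, hc' _ _ _ e, Category.assoc, Category.assoc, ho, reassoc_of% ht]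
        simpa using D.mul_one (f := f ≫ ι₁) rfl
      assoc := fun f g k e e' e₁ e₂ => by
        rw [← cancel_mono ι₁, hc' _ _ _ e₁, hc' _ _ _ e₂, hc' _ _ _ e, hc' _ _ _ e',
          mul_assoc D (hc f g e) (hc g k e')] }
  exact ⟨P.toCat.toStr, homOfElements (D := P.toCat) ι₀ ι₁ hs.symm ht.symm ho
    (fun f g e => (congrArg (· ≫ ι₁) (P.mul_toCat e)).trans (hc' _ f g e)), rfl, rfl⟩

theorem exists_lift_of_mono {D E K : InternalCategory C} (F : E ⟶ D) (h₀ : Mono F.obj)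
    (h₁ : Mono F.mor) (G : K ⟶ D) (hG₀ : ∃ l, l ≫ F.obj = G.obj) (hG₁ : ∃ l, l ≫ F.mor = G.mor) :
    ∃ L : K ⟶ E, L ≫ F = G := by
  obtain ⟨a, ha⟩ := hG₀
  obtain ⟨b, hb⟩ := hG₁
  have hs : b ≫ E.src = K.src ≫ a := by
    rw [← cancel_mono F.obj, Category.assoc, Category.assoc, ha, ← map_src, reassoc_of% hb, map_src]
  have ht : b ≫ E.tgt = K.tgt ≫ a := by
    rw [← cancel_mono F.obj, Category.assoc, Category.assoc, ha, ← map_tgt, reassoc_of% hb, map_tgt]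
  refine ⟨homOfElements a b hs ht ?_ (fun {X} f g e => ?_), hom_ext ha hb⟩
  · rw [← cancel_mono F.mor, Category.assoc, Category.assoc, hb, map_one, map_one, reassoc_of% ha]
  · have e' : (f ≫ b) ≫ E.tgt = (g ≫ b) ≫ E.src := by
      rw [Category.assoc, Category.assoc, hs, ht, reassoc_of% e]
    rw [← cancel_mono F.mor, Category.assoc, hb, mul_map G e, mul_map F e', Category.assoc,
      Category.assoc, hb]

end Sub

end InternalCategory

/-! ### Colimits of double categories -/

namespace CategoryTheory.Cat

/-- The identity of the source of a morphism. -/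
def srcId {A : Cat.{u, u}} (f : Walking ⟶ A) : Walking ⟶ A :=
  pickArrow (𝟙 (f.toFunctor.obj WalkingVertex.src))

/-- The identity of the target of a morphism. -/
def tgtId {A : Cat.{u, u}} (f : Walking ⟶ A) : Walking ⟶ A :=
  pickArrow (𝟙 (f.toFunctor.obj WalkingVertex.tgt))

open Classical in
/-- The composite of two morphisms, equal to the first one if they are not composable. -/
noncomputable def vmul {A : Cat.{u, u}} (f g : Walking ⟶ A) : Walking ⟶ A :=
  if h : f.toFunctor.obj WalkingVertex.tgt = g.toFunctor.obj WalkingVertex.src then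
    pickArrow (f.toFunctor.map walkingArrow ≫ eqToHom h ≫ g.toFunctor.map walkingArrow)
  else f

theorem vmul_pickArrow {A : Cat.{u, u}} {x y z : A} (m : x ⟶ y) (n : y ⟶ z) :
    vmul (pickArrow m) (pickArrow n) = pickArrow (m ≫ n) := by
  refine (dif_pos rfl).trans (congrArg pickArrow (?_ : _ = m ≫ n))
  exact congr($(pickArrow_map m) ≫ $((Category.id_comp _).trans (pickArrow_map n)))

end CategoryTheory.Cat

section

open CategoryTheory.Cat

/-- The terms built from squares of a double category. -/
inductive DblTerm (X : Type u) : Type u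
  | of : X → DblTerm X
  | srcId : DblTerm X → DblTerm X
  | tgtId : DblTerm X → DblTerm X
  | vmul : DblTerm X → DblTerm X → DblTerm X
  | srcOne : DblTerm X → DblTerm X
  | tgtOne : DblTerm X → DblTerm X
  | hmul : DblTerm X → DblTerm X → DblTerm X

namespace DblTerm

variable (D : DblCat.{u}) {X : Type u} (φ : X → (Walking ⟶ D.mor))

/-- The value of a term in a double category. -/
noncomputable def eval : DblTerm X → (Walking ⟶ D.mor)
  | of x => φ x
  | srcId a => Cat.srcId (eval a)
  | tgtId a => Cat.tgtId (eval a)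
  | vmul a b => Cat.vmul (eval a) (eval b)
  | srcOne a => eval a ≫ D.src ≫ D.one
  | tgtOne a => eval a ≫ D.tgt ≫ D.one
  | hmul a b => D.mul (eval a) (eval b)

theorem isClosedSet_range : IsClosedSet (Set.range (eval D φ)) where
  id_src m := by
    rintro ⟨t, ht⟩
    exact ⟨t.srcId, congrArg Cat.srcId ht⟩
  id_tgt m := by
    rintro ⟨t, ht⟩
    exact ⟨t.tgtId, congrArg Cat.tgtId ht⟩
  comp m n := by
    rintro ⟨t, ht⟩ ⟨t', ht'⟩
    exact ⟨t.vmul t', (congrArg₂ Cat.vmul ht ht').trans (vmul_pickArrow m n)⟩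

/-- The squares of the generated sub double category are the values of terms, so its size is bounded
by `DblTerm X`, which does not involve `D`. -/
theorem exists_sub : ∃ (s₀ s₁ : SmallCategoryOfSet (DblTerm X))
    (E : InternalCategory.Str (Cat.of s₀.obj) (Cat.of s₁.obj)) (F : E.toCat ⟶ D),
    ∀ (K : DblCat.{u}) (G : K ⟶ D), (∀ x : Walking ⟶ K.mor, x ≫ G.mor ∈ Set.range φ) →
      ∃! L : K ⟶ E.toCat, L ≫ F = G := by
  have h₁ := isClosedSet_range D φ
  -- A vertical morphism is kept when its horizontal identity is the value of a term. It is the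
  -- source of that square, so terms enumerate the vertical morphisms too (`hmem`).
  have h₀ := h₁.preimage D.one
  have hmem : ∀ {a : Walking ⟶ D.obj}, a ≫ D.one ∈ Set.range (eval D φ) →
      a ∈ Set.range fun t => eval D φ t ≫ D.src := by
    rintro a ⟨t, ht⟩
    exact ⟨t, by simp only [ht, Category.assoc, D.one_src, Category.comp_id]⟩
  obtain ⟨s₁, ι₁, hι₁, H₁⟩ := exists_smallCategoryOfSet_of_isClosedSet h₁ (eval D φ) subset_rfl
  obtain ⟨s₀, ι₀, hι₀, H₀⟩ := exists_smallCategoryOfSet_of_isClosedSet h₀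
    (fun t => eval D φ t ≫ D.src) (fun a ha => hmem ha)
  have hs : InternalCategory.IsSub D ι₀ ι₁ :=
    { mono₀ := hι₀
      mono₁ := hι₁
      src := (H₀ _).2 fun x => by
        obtain ⟨t, ht⟩ := (H₁ _).1 ⟨𝟙 _, Category.id_comp _⟩ x
        exact ⟨t.srcOne, by simp [eval, ht]⟩
      tgt := (H₀ _).2 fun x => by
        obtain ⟨t, ht⟩ := (H₁ _).1 ⟨𝟙 _, Category.id_comp _⟩ x
        exact ⟨t.tgtOne, by simp [eval, ht]⟩
      one := (H₁ _).2 fun x => by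
        simpa using (H₀ _).1 ⟨𝟙 _, Category.id_comp _⟩ x
      comp := fun f g e => (H₁ _).2 fun x => by
        obtain ⟨t, ht⟩ := (H₁ _).1 ⟨f, rfl⟩ x
        obtain ⟨t', ht'⟩ := (H₁ _).1 ⟨g, rfl⟩ x
        exact ⟨t.hmul t', by rw [eval, ht, ht', InternalCategory.comp_mul D x e]⟩ }
  obtain ⟨E, F, rfl, rfl⟩ := hs.exists_str
  refine ⟨s₀, s₁, E, F, fun K G hG => ?_⟩
  have hG₁ : ∀ x : Walking ⟶ K.mor, x ≫ G.mor ∈ Set.range (eval D φ) := fun x => by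
    obtain ⟨a, ha⟩ := hG x
    exact ⟨.of a, ha⟩
  obtain ⟨L, hL⟩ := InternalCategory.exists_lift_of_mono F hι₀ hι₁ G
    ((H₀ _).2 fun x => by simpa using hG₁ (x ≫ K.one)) ((H₁ _).2 hG₁)
  refine ⟨L, hL, fun L' hL' => InternalCategory.hom_ext ?_ ?_⟩
  · exact (cancel_mono F.obj).1 congr(InternalCategory.Hom.obj $(hL'.trans hL.symm))
  · exact (cancel_mono F.mor).1 congr(InternalCategory.Hom.mor $(hL'.trans hL.symm))

end DblTerm

/-- Colimits form a left adjoint to the constant diagram functor, which preserves limits. For the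
solution set, a cocone factors through the sub double category generated by the images of all
squares of the diagram. -/
theorem hasColimits_dblCat : HasColimits DblCat.{u} where
  has_colimits_of_shape J _ := hasColimitsOfShape_iff_isRightAdjoint_const.2
    (isRightAdjoint_of_preservesLimits_of_solutionSetCondition _ fun K => by
      -- `T` depends on the diagram only, so one small family of candidates serves all cocones.
      let T := DblTerm (Σ j, (Walking.{u} ⟶ (K.obj j).mor))
      let B (i : Σ s₀ s₁ : SmallCategoryOfSet T,
          InternalCategory.Str (Cat.of s₀.obj) (Cat.of s₁.obj)) : DblCat.{u} := i.2.2.toCat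
      refine ⟨Σ i, (K ⟶ (Functor.const J).obj (B i)), fun i => B i.1, fun i => i.2, fun D c => ?_⟩
      obtain ⟨s₀, s₁, E, F, h⟩ := DblTerm.exists_sub D
        (fun x : Σ j, (Walking.{u} ⟶ (K.obj j).mor) => x.2 ≫ (c.app x.1).mor)
      choose L hL hL' using fun j => h (K.obj j) (c.app j) (fun x => ⟨⟨j, x⟩, rfl⟩)
      refine ⟨⟨⟨s₀, s₁, E⟩, ⟨L, fun j j' a => ?_⟩⟩, F, ?_⟩
      -- The factorizations `L` form a cocone by uniqueness of factorizations through `F`.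
      · refine (hL' j _ ?_).trans ((hL' j _ ?_).symm)
        · exact (Category.assoc _ _ _).trans ((congrArg (K.map a ≫ ·) (hL j')).trans
            ((c.naturality a).trans (Category.comp_id _)))
        · exact (congrArg (· ≫ F) (Category.comp_id (L j))).trans (hL j)
      · ext j
        exact hL j)

end

/-! ### The model structure on double categories -/

theorem mainTheorem6 :
    (InternalCategory.we tauPrime.{u}).HasTwoOutOfThreeProperty ∧
    EnoughTopologyProjectives tauPrime.{u} ∧
    (∀ A : Cat.{u, u}, IsTopologyProjective tauPrime (Cat.free.obj (Quiv.forget.obj A)) ∧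
      IsTopologyEpi tauPrime (Quiv.adj.counit.app A)) ∧
    (∀ P : Cat.{u, u}, IsTopologyProjective tauPrime P ↔ IsFreeOnGraph P) ∧
    ∃ _ : ModelCategory DblCat.{u},
      weakEquivalences DblCat.{u} = InternalCategory.we tauPrime ∧
      fibrations DblCat.{u} = InternalCategory.fib tauPrime ∧
      cofibrations DblCat.{u} = InternalCategory.cof tauPrime ∧
      ∀ X : DblCat.{u}, IsCofibrant X ↔ IsFreeOnGraph X.obj := by
  have := hasColimits_dblCat.{u}
  refine ⟨InternalCategory.we_hasTwoOutOfThreeProperty _, enoughTopologyProjectives_tauPrime,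
    fun A => ⟨isTopologyProjective_free _, (categoricallySurjective_counit A).isTopologyEpi⟩,
    isTopologyProjective_tauPrime_iff, InternalCategory.modelCategory tauPrime, rfl, rfl, rfl,
    fun X => ?_⟩
  let := InternalCategory.modelCategory tauPrime.{u}
  rw [← isTopologyProjective_tauPrime_iff, ← InternalCategory.cof_initial_iff X]
  exact (isCofibrant_iff X).trans (cofibration_iff _)
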